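/- Let $E$ be a real Banach lattice. A Banach lattice $X$ has the positive Schur property (PSP) if every weakly null sequence of positive elements of $X$ converges to $0$ in norm. For an integer $m\ge 1$: - an $m$-linear form $T\colon E^m\to\mathbb R$ is positive if $T(x_1,\dots,x_m)\ge 0$ whenever $x_1,\dots,x_m\ge 0$, and regular if it is the difference of two positive $m$-linear forms; $\mathcal L^r({}^mE)$ is the Banach lattice of regular $m$-linear forms on $E$, ordered by $S\le T$ if and only if $T-S$ is positive, with the norm $\|T\|_r=\|\,|T|\,\|$; - an $m$-homogeneous polynomial $P\colon E\to\mathbb R$ is a function of the form $P(x)=\check P(x,\dots,x)$ with $\check P$ a (necessarily unique) symmetric $m$-linear form; it is positive if $\check P$ is positive, and regular if it is the difference of two positive $m$-homogeneous polynomials; $\mathcal P^r({}^mE)$ is the Banach lattice of regular $m$-homogeneous polynomials on $E$, ordered by $P\le Q$ if and only if $Q-P$ is positive, with the norm $\|P\|_r=\|\,|P|\,\|$. In both cases $|\cdot|$ is the modulus in the respective lattice, and the outer norm is the usual supremum norm of continuous multilinear forms, respectively of continuous homogeneous polynomials. The dual $E^*$ carries the dual norm and the order $\varphi\le\psi$ if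 and only if $\varphi(x)\le\psi(x)$ for all $x\ge 0$. Then the following are equivalent: 1. $E^*$ has the PSP. 2. $\mathcal L^r({}^mE)$ has the PSP for every integer $m\ge 1$. 3. $\mathcal L^r({}^mE)$ has the PSP for some integer $m\ge 1$. 4. $\mathcal P^r({}^mE)$ has the PSP for every integer $m\ge 1$. 5. $\mathcal P^r({}^mE)$ has the PSP for some integer $m\ge 1$. -/

import Mathlib

open Filter Topology Function

namespace RegularForms

set_option linter.unusedSectionVars false

/-- The positive Schur property of an ordered normed space: every weakly null sequence
of positive elements is norm null. -/
def HasPSP (X : Type*) [NormedAddCommGroup X] [NormedSpace ℝ X] [PartialOrder X] : Prop :=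
  ∀ u : ℕ → X, (∀ n, 0 ≤ u n) →
    (∀ φ : StrongDual ℝ X, Tendsto (fun n => φ (u n)) atTop (𝓝 0)) →
    Tendsto (fun n => ‖u n‖) atTop (𝓝 0)

section Generic

variable {X : Type*} [AddCommGroup X] [Module ℝ X]

/-- An ordered real vector space in which every `x` has a modulus `sup {x, -x}` is a lattice. -/
noncomputable abbrev latticeOfModulus [PartialOrder X] [IsOrderedAddMonoid X] [IsOrderedModule ℝ X]
    (h : ∀ x : X, ∃ y, IsLUB {x, -x} y) : Lattice X :=
  have key : ∀ a b : X, IsLUB {a, b} ((1 / 2 : ℝ) • (a + b + (h (a - b)).choose)) := by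
    intro a b
    have hy := (h (a - b)).choose_spec
    set y := (h (a - b)).choose
    have h1 : a - b ≤ y := hy.1 (by simp)
    have h2 : b - a ≤ y := by simpa using hy.1 (show -(a - b) ∈ ({a - b, -(a - b)} : Set X) by simp)
    have half : ∀ c d : X, c + c ≤ d → c ≤ (1 / 2 : ℝ) • d := by
      intro c d hcd
      have := smul_le_smul_of_nonneg_left hcd (show (0 : ℝ) ≤ 1 / 2 by norm_num)
      rwa [← two_smul ℝ c, smul_smul, show (1 / 2 : ℝ) * 2 = 1 by norm_num, one_smul] at this
    have half' : ∀ c d : X, d ≤ c + c → (1 / 2 : ℝ) • d ≤ c := by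
      intro c d hcd
      have := smul_le_smul_of_nonneg_left hcd (show (0 : ℝ) ≤ 1 / 2 by norm_num)
      rwa [← two_smul ℝ c, smul_smul, show (1 / 2 : ℝ) * 2 = 1 by norm_num, one_smul] at this
    constructor
    · rintro c (rfl | rfl)
      · apply half
        calc c + c = c + b + (c - b) := by abel
          _ ≤ _ := by gcongr
      · apply half
        calc c + c = a + c + (c - a) := by abel
          _ ≤ _ := by gcongr
    · intro c hc
      have hac : a ≤ c := hc (by simp)
      have hbc : b ≤ c := hc (by simp)
      apply half'
      have : y ≤ c + c - a - b := by
        apply hy.2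
        rintro d (rfl | rfl)
        · calc a - b = a + a - a - b := by abel
            _ ≤ _ := by gcongr
        · calc -(a - b) = b + b - a - b := by abel
            _ ≤ _ := by gcongr
      calc a + b + y ≤ a + b + (c + c - a - b) := by gcongr
        _ = c + c := by abel
  { ‹PartialOrder X› with
    sup := fun a b => (1 / 2 : ℝ) • (a + b + (h (a - b)).choose)
    inf := fun a b => -((1 / 2 : ℝ) • (-a + -b + (h (-a - -b)).choose))
    le_sup_left := fun a b => (key a b).1 (Set.mem_insert _ _)
    le_sup_right := fun a b => (key a b).1 (Set.mem_insert_of_mem _ rfl)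
    sup_le := fun a b c hac hbc => (key a b).2 (by rintro d (rfl | rfl) <;> assumption)
    inf_le_left := fun a b => neg_le.1 ((key (-a) (-b)).1 (Set.mem_insert _ _))
    inf_le_right := fun a b => neg_le.1 ((key (-a) (-b)).1 (Set.mem_insert_of_mem _ rfl))
    le_inf := fun a b c hab hac =>
      le_neg.1 ((key (-b) (-c)).2 (by
        rintro d (rfl | rfl)
        · exact neg_le_neg hab
        · exact neg_le_neg hac)) }

variable [Lattice X] [IsOrderedAddMonoid X] [IsOrderedModule ℝ X]

theorem abs_smul_le (c : ℝ) (x : X) : |c • x| ≤ |c| • |x| := by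
  have hn : ∀ y : X, |c| • y = c • y ∨ |c| • y = -(c • y) := by
    intro y
    rcases abs_choice c with h | h <;> simp [h]
  have h1 : ∀ y : X, y ≤ |x| → -y ≤ |x| → c • y ≤ |c| • |x| := by
    intro y hy hy'
    have a1 := smul_le_smul_of_nonneg_left hy (abs_nonneg c)
    have a2 := smul_le_smul_of_nonneg_left hy' (abs_nonneg c)
    rcases hn y with h | h
    · rwa [h] at a1
    · rwa [smul_neg, h, neg_neg] at a2
  refine sup_le (h1 x (le_abs_self x) (neg_le_abs x)) ?_
  rw [← smul_neg]
  exact h1 (-x) (neg_le_abs x) (by simpa using le_abs_self x)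

/-- A norm of the form `x ↦ p |x|`. -/
theorem coreOfAbs [Norm X] (p : X → ℝ) (hp : ∀ x : X, ‖x‖ = p |x|)
    (p_nonneg : ∀ x, 0 ≤ p x) (p_mono : ∀ x y, 0 ≤ x → x ≤ y → p x ≤ p y)
    (p_add : ∀ x y, p (x + y) ≤ p x + p y) (p_smul : ∀ (c : ℝ) (x), 0 ≤ c → p (c • x) = c * p x)
    (p_zero : ∀ x, 0 ≤ x → p x = 0 → x = 0) : NormedSpace.Core ℝ X := by
  have le : ∀ (c : ℝ) (x : X), p |c • x| ≤ |c| * p |x| := fun c x => by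
    rw [← p_smul _ _ (abs_nonneg c)]
    exact p_mono _ _ (abs_nonneg _) (abs_smul_le c x)
  have p0 : p 0 = 0 := by simpa using p_smul 0 0 le_rfl
  refine { norm_nonneg := fun x => ?_, norm_smul := fun c x => ?_, norm_triangle := fun x y => ?_,
           norm_eq_zero_iff := fun x => ?_ }
  · rw [hp]; exact p_nonneg _
  · rw [hp, hp, Real.norm_eq_abs]
    apply le_antisymm (le c x)
    rcases eq_or_ne c 0 with rfl | hc
    · simpa using p_nonneg _
    · have := le c⁻¹ (c • x)
      rw [smul_smul, inv_mul_cancel₀ hc, one_smul, abs_inv] at this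
      have hc' : 0 < |c| := abs_pos.2 hc
      calc |c| * p |x| ≤ |c| * (|c|⁻¹ * p |c • x|) := by gcongr
        _ = p |c • x| := by field_simp
  · rw [hp, hp, hp]
    exact (p_mono _ _ (abs_nonneg _) (abs_add_le x y)).trans (p_add _ _)
  · rw [hp]
    constructor
    · intro h
      have h0 := p_zero _ (abs_nonneg x) h
      have h1 : x ≤ 0 := h0 ▸ le_abs_self x
      have h2 : -x ≤ 0 := h0 ▸ neg_le_abs x
      exact le_antisymm h1 (by simpa using h2)
    · rintro rfl
      simpa using p0

end Generic

section Forms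

variable {m : ℕ} {E : Type*} [AddCommGroup E] [Module ℝ E]

section Defs

variable [PartialOrder E]

/-- An `m`-linear form is positive if it is nonnegative on tuples of positive vectors. -/
def IsPositive (T : MultilinearMap ℝ (fun _ : Fin m => E) ℝ) : Prop :=
  ∀ x : Fin m → E, (∀ i, 0 ≤ x i) → 0 ≤ T x

/-- An `m`-linear form is symmetric if it is invariant under permutations of its arguments. -/
def IsSymmetric (T : MultilinearMap ℝ (fun _ : Fin m => E) ℝ) : Prop :=
  ∀ (σ : Equiv.Perm (Fin m)) (x : Fin m → E), T (fun i => x (σ i)) = T x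

end Defs

variable [Lattice E] [IsOrderedAddMonoid E]

theorem riesz {a b c d : E} (ha : 0 ≤ a) (hb : 0 ≤ b) (hc : 0 ≤ c) (hd : 0 ≤ d)
    (h : c + d = a + b) : ∃ c₁ c₂ d₁ d₂ : E, 0 ≤ c₁ ∧ 0 ≤ c₂ ∧ 0 ≤ d₁ ∧ 0 ≤ d₂ ∧
      c₁ + c₂ = c ∧ d₁ + d₂ = d ∧ c₁ + d₁ = a ∧ c₂ + d₂ = b := by
  refine ⟨c ⊓ a, c - c ⊓ a, a - c ⊓ a, b - c + c ⊓ a, le_inf hc ha, by simp, by simp, ?_,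
    by abel, ?_, by abel, by abel⟩
  · have : c - b ≤ c ⊓ a := by
      refine le_inf (by simpa using hb) ?_
      rw [sub_le_iff_le_add, ← h]
      simpa using hd
    have h2 := sub_nonneg.2 this
    calc (0 : E) ≤ c ⊓ a - (c - b) := h2
      _ = b - c + c ⊓ a := by abel
  · calc a - c ⊓ a + (b - c + c ⊓ a) = (a + b) - c := by abel
      _ = d := by rw [← h]; abel


/-- Replacing an entry of a positive tuple by a positive vector. -/
theorem nonneg_update {x : Fin m → E} (hx : ∀ i, 0 ≤ x i) (i : Fin m) {a : E} (ha : 0 ≤ a) :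
    ∀ j, 0 ≤ update x i a j := by
  intro j
  rcases eq_or_ne j i with rfl | h
  · simpa using ha
  · simpa [h] using hx j

/-- Functions dominating `|T|` on positive tuples and superadditive there in each variable. -/
def superMajorants (T : MultilinearMap ℝ (fun _ : Fin m => E) ℝ) : Set ((Fin m → E) → ℝ) :=
  {g | (∀ x, (∀ i, 0 ≤ x i) → |T x| ≤ g x) ∧
    ∀ x, (∀ i, 0 ≤ x i) → ∀ i, ∀ a b : E, 0 ≤ a → 0 ≤ b →
      g (update x i a) + g (update x i b) ≤ g (update x i (a + b))}

/-- The least superadditive majorant, on positive tuples. -/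
noncomputable def leastMajorant (T : MultilinearMap ℝ (fun _ : Fin m => E) ℝ) (x : Fin m → E) : ℝ :=
  ⨅ g : superMajorants T, g.1 x

theorem leastMajorant_le {T : MultilinearMap ℝ (fun _ : Fin m => E) ℝ} {g : (Fin m → E) → ℝ}
    (hg : g ∈ superMajorants T) {x : Fin m → E} (hx : ∀ i, 0 ≤ x i) : leastMajorant T x ≤ g x :=
  ciInf_le (f := fun g : superMajorants T => g.1 x)
    ⟨|T x|, by rintro _ ⟨g, rfl⟩; exact g.2.1 x hx⟩ ⟨g, hg⟩

theorem leastMajorant_mem {T : MultilinearMap ℝ (fun _ : Fin m => E) ℝ}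
    (hT : (superMajorants T).Nonempty) : leastMajorant T ∈ superMajorants T := by
  have : Nonempty (superMajorants T) := hT.to_subtype
  refine ⟨fun x hx => le_ciInf fun g => g.2.1 x hx, fun x hx i a b ha hb => le_ciInf fun g => ?_⟩
  refine le_trans ?_ (g.2.2 x hx i a b ha hb)
  exact add_le_add (leastMajorant_le g.2 (nonneg_update hx i ha))
    (leastMajorant_le g.2 (nonneg_update hx i hb))

theorem leastMajorant_add {T : MultilinearMap ℝ (fun _ : Fin m => E) ℝ}
    (hT : (superMajorants T).Nonempty) {x : Fin m → E} (hx : ∀ i, 0 ≤ x i) (i : Fin m)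
    {a b : E} (ha : 0 ≤ a) (hb : 0 ≤ b) :
    leastMajorant T (update x i (a + b)) =
      leastMajorant T (update x i a) + leastMajorant T (update x i b) := by
  obtain ⟨hG1, hG2⟩ := leastMajorant_mem hT
  refine le_antisymm ?_ (hG2 x hx i a b ha hb)
  set G := leastMajorant T
  let D : E → Type _ := fun c => {p : E × E // 0 ≤ p.1 ∧ 0 ≤ p.2 ∧ p.1 + p.2 = c}
  let H : (Fin m → E) → ℝ := fun y =>
    ⨅ p : D (y i), (G (update y i p.1.1) + G (update y i p.1.2))
  have hD : ∀ c : E, 0 ≤ c → Nonempty (D c) := fun c hc => ⟨⟨(c, 0), hc, le_rfl, by simp⟩⟩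
  have G0 : ∀ y : Fin m → E, (∀ j, 0 ≤ y j) → 0 ≤ G y := fun y hy =>
    (abs_nonneg _).trans (hG1 y hy)
  have hH : ∀ y : Fin m → E, (∀ j, 0 ≤ y j) → ∀ c d : E, 0 ≤ c → 0 ≤ d → c + d = y i →
      H y ≤ G (update y i c) + G (update y i d) := by
    intro y hy c d hc hd h
    refine ciInf_le (f := fun p : D (y i) => G (update y i p.1.1) + G (update y i p.1.2))
      ⟨0, ?_⟩ ⟨(c, d), hc, hd, h⟩
    rintro _ ⟨p, rfl⟩
    exact add_nonneg (G0 _ (nonneg_update hy i p.2.1)) (G0 _ (nonneg_update hy i p.2.2.1))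
  have hmem : H ∈ superMajorants T := by
    refine ⟨fun y hy => ?_, fun y hy k u v hu hv => ?_⟩
    · have := hD _ (hy i)
      refine le_ciInf fun p => ?_
      have e : T y = T (update y i p.1.1) + T (update y i p.1.2) := by
        rw [← T.map_update_add, p.2.2.2, update_eq_self]
      rw [e]
      exact (abs_add_le _ _).trans (add_le_add (hG1 _ (nonneg_update hy i p.2.1))
        (hG1 _ (nonneg_update hy i p.2.2.1)))
    · have hyuv := nonneg_update hy k (add_nonneg hu hv)
      have hyu := nonneg_update hy k hu
      have hyv := nonneg_update hy k hv
      have := hD _ (hyuv i)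
      refine le_ciInf fun p => ?_
      obtain ⟨⟨c, d⟩, hc, hd, hcd⟩ := p
      simp only at hc hd hcd ⊢
      rcases eq_or_ne k i with rfl | hki
      · simp only [update_self] at hcd
        obtain ⟨c₁, c₂, d₁, d₂, hc₁, hc₂, hd₁, hd₂, rfl, rfl, rfl, rfl⟩ := riesz hu hv hc hd hcd
        have e1 := hH _ hyu c₁ d₁ hc₁ hd₁ (by simp)
        have e2 := hH _ hyv c₂ d₂ hc₂ hd₂ (by simp)
        have e3 := hG2 y hy k c₁ c₂ hc₁ hc₂
        have e4 := hG2 y hy k d₁ d₂ hd₁ hd₂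
        simp only [update_idem] at *
        linarith
      · rw [update_of_ne hki.symm] at hcd
        have e1 := hH _ hyu c d hc hd (by rw [update_of_ne hki.symm, hcd])
        have e2 := hH _ hyv c d hc hd (by rw [update_of_ne hki.symm, hcd])
        have e3 := hG2 _ (nonneg_update hy i hc) k u v hu hv
        have e4 := hG2 _ (nonneg_update hy i hd) k u v hu hv
        simp only [update_comm hki] at *
        linarith
  have hxab := nonneg_update hx i (add_nonneg ha hb)
  have := (leastMajorant_le hmem hxab).trans (hH _ hxab a b ha hb (by simp))
  simpa only [update_idem] using this

variable [IsOrderedModule ℝ E]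

theorem leastMajorant_smul {T : MultilinearMap ℝ (fun _ : Fin m => E) ℝ}
    (hT : (superMajorants T).Nonempty) {x : Fin m → E} (hx : ∀ i, 0 ≤ x i) (i : Fin m)
    {c : ℝ} (hc : 0 < c) {a : E} (ha : 0 ≤ a) :
    leastMajorant T (update x i (c • a)) = c * leastMajorant T (update x i a) := by
  obtain ⟨hG1, hG2⟩ := leastMajorant_mem hT
  set G := leastMajorant T with hG
  have key : ∀ t : ℝ, 0 < t → ∀ y : Fin m → E, (∀ j, 0 ≤ y j) →
      G y ≤ t⁻¹ * G (update y i (t • y i)) := by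
    intro t ht y hy
    refine leastMajorant_le (g := fun y => t⁻¹ * G (update y i (t • y i)))
      ⟨fun z hz => ?_, fun z hz k u v hu hv => ?_⟩ hy
    · have := hG1 _ (nonneg_update hz i (smul_nonneg ht.le (hz i)))
      rw [T.map_update_smul, update_eq_self, smul_eq_mul, abs_mul, abs_of_pos ht] at this
      change |T z| ≤ t⁻¹ * G (update z i (t • z i))
      rw [inv_mul_eq_div, le_div_iff₀ ht]
      linarith
    · simp only
      rw [← mul_add]
      refine mul_le_mul_of_nonneg_left ?_ (inv_nonneg.2 ht.le)
      rcases eq_or_ne k i with rfl | hki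
      · simpa using hG2 z hz k _ _ (smul_nonneg ht.le hu) (smul_nonneg ht.le hv)
      · have := hG2 _ (nonneg_update hz i (smul_nonneg ht.le (hz i))) k u v hu hv
        simp only [update_comm hki, update_of_ne hki.symm] at *
        exact this
  apply le_antisymm
  · have := key c⁻¹ (inv_pos.2 hc) _ (nonneg_update hx i (smul_nonneg hc.le ha))
    simpa [smul_smul, inv_mul_cancel₀ hc.ne'] using this
  · have := key c hc _ (nonneg_update hx i ha)
    simp only [update_self, update_idem] at this
    rwa [inv_mul_eq_div, le_div_iff₀ hc, mul_comm] at this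

section Extension

/-- The sign attached to a Boolean. -/
def sg (b : Bool) : ℝ := if b then 1 else -1

/-- The positive or the negative part of a vector. -/
def part (b : Bool) (a : E) : E := if b then a⁺ else a⁻

theorem part_nonneg (b : Bool) (a : E) : 0 ≤ part b a := by
  cases b <;> simp [part]

/-- The extension of a function on positive tuples to all tuples by signed summation. -/
noncomputable def ext (G : (Fin m → E) → ℝ) (x : Fin m → E) : ℝ :=
  ∑ ε : Fin m → Bool, (∏ i, sg (ε i)) * G (fun i => part (ε i) (x i))

/-- Negating the `i`-th entry of a tuple of Booleans. -/
def flip (i : Fin m) (ε : Fin m → Bool) : Fin m → Bool := update ε i (!ε i)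

theorem flip_flip (i : Fin m) : Involutive (flip (m := m) i) := fun ε => by
  simp [flip]

theorem two_mul_ext (G : (Fin m → E) → ℝ) (x : Fin m → E) (i : Fin m) :
    2 * ext G x = ∑ ε : Fin m → Bool, (∏ j ∈ Finset.univ.erase i, sg (ε j)) *
      (G (update (fun j => part (ε j) (x j)) i (x i)⁺) -
        G (update (fun j => part (ε j) (x j)) i (x i)⁻)) := by
  have h : ext G x = ∑ ε : Fin m → Bool,
      (∏ j, sg (flip i ε j)) * G (fun j => part (flip i ε j) (x j)) :=
    (Equiv.sum_comp (flip_flip i).toPerm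
      (fun ε : Fin m → Bool => (∏ j, sg (ε j)) * G (fun j => part (ε j) (x j)))).symm
  rw [two_mul]
  nth_rewrite 2 [h]
  rw [ext, ← Finset.sum_add_distrib]
  refine Finset.sum_congr rfl fun ε _ => ?_
  have e1 : ∀ ε : Fin m → Bool, (∏ j, sg (ε j)) = sg (ε i) * ∏ j ∈ Finset.univ.erase i, sg (ε j) :=
    fun ε => (Finset.mul_prod_erase _ _ (Finset.mem_univ i)).symm
  have e2 : ∏ j ∈ Finset.univ.erase i, sg (flip i ε j) = ∏ j ∈ Finset.univ.erase i, sg (ε j) :=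
    Finset.prod_congr rfl fun j hj => by rw [flip, update_of_ne (Finset.ne_of_mem_erase hj)]
  have e3 : (fun j => part (flip i ε j) (x j)) =
      update (fun j => part (ε j) (x j)) i (part (!ε i) (x i)) := by
    ext j
    rcases eq_or_ne j i with rfl | h
    · simp [flip]
    · simp [flip, h]
  have e4 : (fun j => part (ε j) (x j)) =
      update (fun j => part (ε j) (x j)) i (part (ε i) (x i)) := by simp
  rw [e1, e1 (flip i ε), e2, e3]
  nth_rewrite 1 [e4]
  have e5 : flip i ε i = !ε i := by simp [flip]
  rw [e5]
  cases ε i <;> simp [sg, part] <;> ring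

theorem exists_extension (G : (Fin m → E) → ℝ)
    (hadd : ∀ x : Fin m → E, (∀ i, 0 ≤ x i) → ∀ i, ∀ a b : E, 0 ≤ a → 0 ≤ b →
      G (update x i (a + b)) = G (update x i a) + G (update x i b))
    (hsmul : ∀ x : Fin m → E, (∀ i, 0 ≤ x i) → ∀ i, ∀ c : ℝ, 0 < c → ∀ a : E, 0 ≤ a →
      G (update x i (c • a)) = c * G (update x i a)) :
    ∃ M : MultilinearMap ℝ (fun _ : Fin m => E) ℝ, ∀ x, (∀ i, 0 ≤ x i) → M x = G x := by
  let D : (Fin m → E) → Fin m → E → ℝ := fun z i c => G (update z i c⁺) - G (update z i c⁻)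
  have hzero : ∀ z : Fin m → E, (∀ i, 0 ≤ z i) → ∀ i, G (update z i 0) = 0 := by
    intro z hz i
    have := hadd z hz i 0 0 le_rfl le_rfl
    simp only [add_zero] at this
    linarith
  have hDsub : ∀ z : Fin m → E, (∀ i, 0 ≤ z i) → ∀ i, ∀ p q : E, 0 ≤ p → 0 ≤ q →
      D z i (p - q) = G (update z i p) - G (update z i q) := by
    intro z hz i p q hp hq
    have e : (p - q)⁺ + q = (p - q)⁻ + p := by
      have := posPart_sub_negPart (p - q)
      rw [sub_eq_iff_eq_add] at this
      rw [this]; abel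
    have e1 := hadd z hz i _ _ (posPart_nonneg (p - q)) hq
    have e2 := hadd z hz i _ _ (negPart_nonneg (p - q)) hp
    rw [e] at e1
    simp only [D]
    linarith
  have hDadd : ∀ z : Fin m → E, (∀ i, 0 ≤ z i) → ∀ i, ∀ a b : E,
      D z i (a + b) = D z i a + D z i b := by
    intro z hz i a b
    have e : a + b = (a⁺ + b⁺) - (a⁻ + b⁻) := by
      nth_rewrite 1 [← posPart_sub_negPart a, ← posPart_sub_negPart b]
      abel
    rw [e, hDsub z hz i _ _ (add_nonneg (posPart_nonneg a) (posPart_nonneg b))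
      (add_nonneg (negPart_nonneg a) (negPart_nonneg b)),
      hadd z hz i _ _ (posPart_nonneg a) (posPart_nonneg b),
      hadd z hz i _ _ (negPart_nonneg a) (negPart_nonneg b)]
    simp only [D]
    ring
  have hDpos : ∀ z : Fin m → E, (∀ i, 0 ≤ z i) → ∀ i, ∀ c : ℝ, 0 < c → ∀ a : E,
      D z i (c • a) = c * D z i a := by
    intro z hz i c hc a
    have e : c • a = c • a⁺ - c • a⁻ := by rw [← smul_sub, posPart_sub_negPart]
    rw [e, hDsub z hz i _ _ (smul_nonneg hc.le (posPart_nonneg a))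
      (smul_nonneg hc.le (negPart_nonneg a)), hsmul z hz i c hc _ (posPart_nonneg a),
      hsmul z hz i c hc _ (negPart_nonneg a)]
    simp only [D]
    ring
  have hD0 : ∀ z : Fin m → E, (∀ i, 0 ≤ z i) → ∀ i, D z i 0 = 0 := by
    intro z hz i
    have := hDadd z hz i 0 0
    rw [add_zero] at this
    linarith
  have hDsmul : ∀ z : Fin m → E, (∀ i, 0 ≤ z i) → ∀ i, ∀ c : ℝ, ∀ a : E,
      D z i (c • a) = c * D z i a := by
    intro z hz i c a
    rcases lt_trichotomy c 0 with hc | rfl | hc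
    · have e := hDadd z hz i (c • a) ((-c) • a)
      rw [← add_smul, add_neg_cancel, zero_smul, hD0 z hz i,
        hDpos z hz i (-c) (neg_pos.2 hc) a] at e
      linarith
    · simp [hD0 z hz i]
    · exact hDpos z hz i c hc a
  have hrep : ∀ (x : Fin m → E) (i : Fin m) (c : E), 2 * ext G (update x i c) =
      ∑ ε : Fin m → Bool, (∏ j ∈ Finset.univ.erase i, sg (ε j)) *
        D (fun j => part (ε j) (x j)) i c := by
    intro x i c
    rw [two_mul_ext _ _ i]
    refine Finset.sum_congr rfl fun ε _ => ?_
    have e : ∀ d : E, update (fun j => part (ε j) (update x i c j)) i d =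
        update (fun j => part (ε j) (x j)) i d := by
      intro d
      ext j
      rcases eq_or_ne j i with rfl | h
      · simp
      · simp [h]
    simp only [update_self, e, D]
  have hz : ∀ (ε : Fin m → Bool) (x : Fin m → E), ∀ j, 0 ≤ (fun j => part (ε j) (x j)) j :=
    fun ε x j => part_nonneg _ _
  refine ⟨⟨ext G, ?_, ?_⟩, ?_⟩
  · intro inst x i a b
    obtain rfl : inst = instDecidableEqFin m := Subsingleton.elim _ _
    have : 2 * ext G (update x i (a + b)) =
        2 * ext G (update x i a) + 2 * ext G (update x i b) := by
      rw [hrep, hrep, hrep, ← Finset.sum_add_distrib]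
      refine Finset.sum_congr rfl fun ε _ => ?_
      rw [hDadd _ (hz ε x), mul_add]
    linarith
  · intro inst x i c a
    obtain rfl : inst = instDecidableEqFin m := Subsingleton.elim _ _
    have : 2 * ext G (update x i (c • a)) = c * (2 * ext G (update x i a)) := by
      rw [hrep, hrep, Finset.mul_sum]
      refine Finset.sum_congr rfl fun ε _ => ?_
      rw [hDsmul _ (hz ε x)]
      ring
    rw [smul_eq_mul]
    linarith
  · intro x hx
    change ext G x = G x
    rw [ext, Finset.sum_eq_single (fun _ => true)]
    · simp [sg, part, posPart_eq_self.2 (hx _)]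
    · intro ε _ hε
      obtain ⟨i, hi⟩ : ∃ i, ε i = false := by
        by_contra! h
        exact hε (funext fun i => by simpa using h i)
      have e4 : (fun j => part (ε j) (x j)) = update (fun j => part (ε j) (x j)) i 0 := by
        conv_lhs => rw [← update_eq_self i (fun j => part (ε j) (x j))]
        simp [hi, part, negPart_eq_zero.2 (hx i)]
      rw [e4, hzero _ (hz ε x), mul_zero]
    · simp

end Extension

/-- The modulus of an `m`-linear form dominated by a positive one. -/
theorem exists_modulus {T S : MultilinearMap ℝ (fun _ : Fin m => E) ℝ}
    (h : ∀ x, (∀ i, 0 ≤ x i) → |T x| ≤ S x) :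
    ∃ M : MultilinearMap ℝ (fun _ : Fin m => E) ℝ, (∀ x, (∀ i, 0 ≤ x i) → |T x| ≤ M x) ∧
      ∀ R : MultilinearMap ℝ (fun _ : Fin m => E) ℝ, (∀ x, (∀ i, 0 ≤ x i) → |T x| ≤ R x) →
        ∀ x, (∀ i, 0 ≤ x i) → M x ≤ R x := by
  have mem : ∀ R : MultilinearMap ℝ (fun _ : Fin m => E) ℝ,
      (∀ x, (∀ i, 0 ≤ x i) → |T x| ≤ R x) → (⇑R) ∈ superMajorants T := fun R hR =>
    ⟨hR, fun x _ i a b _ _ => (R.map_update_add x i a b).ge⟩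
  have hne : (superMajorants T).Nonempty := ⟨_, mem S h⟩
  obtain ⟨M, hM⟩ := exists_extension (leastMajorant T)
    (fun x hx i a b ha hb => leastMajorant_add hne hx i ha hb)
    (fun x hx i c hc a ha => leastMajorant_smul hne hx i hc ha)
  refine ⟨M, fun x hx => ?_, fun R hR x hx => ?_⟩
  · rw [hM x hx]
    exact (leastMajorant_mem hne).1 x hx
  · rw [hM x hx]
    exact leastMajorant_le (mem R hR) hx

theorem IsPositive.add {A B : MultilinearMap ℝ (fun _ : Fin m => E) ℝ} (hA : IsPositive A)
    (hB : IsPositive B) : IsPositive (A + B) := fun x hx => add_nonneg (hA x hx) (hB x hx)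

theorem IsPositive.smul {A : MultilinearMap ℝ (fun _ : Fin m => E) ℝ} (hA : IsPositive A)
    {c : ℝ} (hc : 0 ≤ c) : IsPositive (c • A) := fun x hx => mul_nonneg hc (hA x hx)

theorem IsPositive.mono {A : MultilinearMap ℝ (fun _ : Fin m => E) ℝ} (hA : IsPositive A)
    {x y : Fin m → E} (hx : ∀ i, 0 ≤ x i) (hxy : ∀ i, x i ≤ y i) : A x ≤ A y := by
  have e : y = (y - x) + x := by simp
  rw [e, A.map_add_univ]
  have := Finset.single_le_sum (f := fun s : Finset (Fin m) => A (s.piecewise (y - x) x))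
    (fun s _ => hA _ fun i => ?_) (Finset.mem_univ ∅)
  · simpa using this
  · by_cases hi : i ∈ s
    · simpa [hi] using hxy i
    · simpa [hi] using hx i

theorem IsPositive.abs_le {A : MultilinearMap ℝ (fun _ : Fin m => E) ℝ} (hA : IsPositive A)
    (x : Fin m → E) : |A x| ≤ A (fun i => |x i|) := by
  have e1 : x = (fun i => (x i)⁺) + (fun i => -(x i)⁻) := by
    ext i
    simp [← sub_eq_add_neg, posPart_sub_negPart]
  have e2 : (fun i => |x i|) = (fun i => (x i)⁺) + (fun i => (x i)⁻) := by
    ext i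
    simp [posPart_add_negPart]
  rw [e2, A.map_add_univ]
  nth_rewrite 1 [e1]
  rw [A.map_add_univ]
  refine (Finset.abs_sum_le_sum_abs _ _).trans (Finset.sum_le_sum fun s _ => ?_)
  have e3 : s.piecewise (fun i => (x i)⁺) (fun i => -(x i)⁻) =
      fun i => (if i ∈ s then (1 : ℝ) else -1) •
        s.piecewise (fun i => (x i)⁺) (fun i => (x i)⁻) i := by
    ext i
    by_cases hi : i ∈ s <;> simp [hi]
  have hpos : 0 ≤ A (s.piecewise (fun i => (x i)⁺) (fun i => (x i)⁻)) := by
    refine hA _ fun i => ?_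
    by_cases hi : i ∈ s <;> simp [hi]
  rw [e3, A.map_smul_univ, smul_eq_mul, abs_mul, abs_of_nonneg hpos, Finset.abs_prod]
  rw [Finset.prod_eq_one, one_mul]
  intro i _
  split_ifs <;> simp

theorem ext_of_positive {A B : MultilinearMap ℝ (fun _ : Fin m => E) ℝ}
    (h : ∀ x, (∀ i, 0 ≤ x i) → A x = B x) : A = B := by
  have h0 : IsPositive (A - B) := fun x hx => by simp [h x hx]
  ext x
  have := h0.abs_le x
  rw [sub_apply, sub_apply,
    h _ (fun i => abs_nonneg (x i)), sub_self] at this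
  exact sub_eq_zero.1 (abs_nonpos_iff.1 this)

/-- An `m`-linear form is regular if it is the difference of two positive `m`-linear forms. -/
def IsRegular (T : MultilinearMap ℝ (fun _ : Fin m => E) ℝ) : Prop :=
  ∃ A B : MultilinearMap ℝ (fun _ : Fin m => E) ℝ, IsPositive A ∧ IsPositive B ∧ T = A - B

variable (m E) in
/-- The vector space of regular `m`-linear forms. -/
def regFormSubmodule : Submodule ℝ (MultilinearMap ℝ (fun _ : Fin m => E) ℝ) where
  carrier := {T | IsRegular T}
  zero_mem' := ⟨0, 0, fun _ _ => le_rfl, fun _ _ => le_rfl, by simp⟩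
  add_mem' := by
    rintro _ _ ⟨A, B, hA, hB, rfl⟩ ⟨C, D, hC, hD, rfl⟩
    exact ⟨A + C, B + D, hA.add hC, hB.add hD, by abel⟩
  smul_mem' := by
    rintro c _ ⟨A, B, hA, hB, rfl⟩
    rcases le_total 0 c with hc | hc
    · exact ⟨c • A, c • B, hA.smul hc, hB.smul hc, smul_sub _ _ _⟩
    · refine ⟨(-c) • B, (-c) • A, hB.smul (neg_nonneg.2 hc), hA.smul (neg_nonneg.2 hc), by module⟩

variable (m E) in
/-- The space of regular `m`-linear forms on `E`, with its order and its regular norm below. -/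
def RegForm : Type _ := regFormSubmodule m E

noncomputable instance : AddCommGroup (RegForm m E) :=
  inferInstanceAs (AddCommGroup (regFormSubmodule m E))

noncomputable instance : Module ℝ (RegForm m E) :=
  inferInstanceAs (Module ℝ (regFormSubmodule m E))

/-- The underlying `m`-linear form. -/
def RegForm.form (T : RegForm m E) : MultilinearMap ℝ (fun _ : Fin m => E) ℝ := T.1

theorem RegForm.form_injective : Injective (RegForm.form (m := m) (E := E)) :=
  Subtype.val_injective

/-- `T ≤ S` if `S - T` is a positive form. -/
instance : PartialOrder (RegForm m E) where
  le T S := IsPositive (S.form - T.form)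
  le_refl T x _ := by simp
  le_trans _ _ _ h₁ h₂ := by
    have := h₁.add h₂
    rwa [sub_add_sub_cancel'] at this
  le_antisymm T S h₁ h₂ := by
    refine RegForm.form_injective (ext_of_positive fun x hx => le_antisymm ?_ ?_)
    · exact sub_nonneg.1 (h₁ x hx)
    · exact sub_nonneg.1 (h₂ x hx)

theorem RegForm.le_iff {T S : RegForm m E} :
    T ≤ S ↔ ∀ x : Fin m → E, (∀ i, 0 ≤ x i) → T.form x ≤ S.form x :=
  forall₂_congr fun _ _ => sub_nonneg

theorem RegForm.nonneg_iff {T : RegForm m E} : 0 ≤ T ↔ IsPositive T.form := RegForm.le_iff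

instance : IsOrderedAddMonoid (RegForm m E) where
  add_le_add_left _ _ h R := RegForm.le_iff.2 fun x hx =>
    add_le_add_left (RegForm.le_iff.1 h x hx) (R.form x)

instance : IsOrderedModule ℝ (RegForm m E) :=
  .of_smul_nonneg fun _ hc _ hT => RegForm.nonneg_iff.2 ((RegForm.nonneg_iff.1 hT).smul hc)

theorem RegForm.isLUB_iff {T M : RegForm m E} (h₁ : ∀ x, (∀ i, 0 ≤ x i) → |T.form x| ≤ M.form x)
    (h₂ : ∀ R : MultilinearMap ℝ (fun _ : Fin m => E) ℝ,
      (∀ x, (∀ i, 0 ≤ x i) → |T.form x| ≤ R x) → ∀ x, (∀ i, 0 ≤ x i) → M.form x ≤ R x) :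
    IsLUB {T, -T} M := by
  constructor
  · rintro S (rfl | rfl)
    · exact RegForm.le_iff.2 fun x hx => (le_abs_self _).trans (h₁ x hx)
    · exact RegForm.le_iff.2 fun x hx => (neg_le_abs _).trans (h₁ x hx)
  · intro R hR
    refine RegForm.le_iff.2 (h₂ R.form fun x hx => ?_)
    exact sup_le (RegForm.le_iff.1 (hR (Set.mem_insert _ _)) x hx)
      (RegForm.le_iff.1 (hR (Set.mem_insert_of_mem _ rfl)) x hx)

theorem RegForm.dominated (T : RegForm m E) :
    ∃ S : MultilinearMap ℝ (fun _ : Fin m => E) ℝ, ∀ x, (∀ i, 0 ≤ x i) → |T.form x| ≤ S x := by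
  obtain ⟨A, B, hA, hB, h⟩ := T.2
  refine ⟨A + B, fun x hx => ?_⟩
  change |T.1 x| ≤ _
  rw [h]
  have a := hA x hx
  have b := hB x hx
  simp only [sub_apply, add_apply]
  rw [_root_.abs_le]
  constructor <;> linarith

/-- The regular forms are a vector lattice. -/
noncomputable instance : Lattice (RegForm m E) :=
  latticeOfModulus fun T => by
    obtain ⟨S, hS⟩ := T.dominated
    obtain ⟨M, hM₁, hM₂⟩ := exists_modulus hS
    have hM : IsRegular M := ⟨M, 0, fun x hx => (abs_nonneg _).trans (hM₁ x hx),
      fun _ _ => le_rfl, by simp⟩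
    exact ⟨⟨M, hM⟩, RegForm.isLUB_iff hM₁ hM₂⟩

end Forms

section Continuity

variable {m : ℕ} {E : Type*} [NormedAddCommGroup E] [NormedSpace ℝ E] [Lattice E]
  [IsOrderedAddMonoid E] [IsOrderedModule ℝ E] [HasSolidNorm E] [CompleteSpace E]

/-- Positive forms on a Banach lattice are bounded. -/
theorem IsPositive.bounded {A : MultilinearMap ℝ (fun _ : Fin m => E) ℝ} (hA : IsPositive A) :
    ∃ C : ℝ, 0 ≤ C ∧ ∀ x, ‖A x‖ ≤ C * ∏ i, ‖x i‖ := by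
  obtain ⟨C, hC⟩ : ∃ C : ℝ, ∀ x, (∀ i, 0 ≤ x i) → (∀ i, ‖x i‖ ≤ 1) → A x ≤ C := by
    by_contra! h
    choose x hx0 hx1 hx2 using fun n : ℕ => h ((n : ℝ) * (2 ^ n) ^ m)
    have hs : ∀ i, Summable fun n : ℕ => ((1 / 2 : ℝ) ^ n) • x n i := fun i => by
      refine Summable.of_norm_bounded summable_geometric_two fun n => ?_
      rw [norm_smul, norm_pow, Real.norm_of_nonneg (by norm_num : (0 : ℝ) ≤ 1 / 2)]
      exact mul_le_of_le_one_right (by positivity) (hx1 n i)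
    obtain ⟨n, hn⟩ := exists_nat_gt (A fun i => ∑' n : ℕ, ((1 / 2 : ℝ) ^ n) • x n i)
    have h1 : A (fun i => ((1 / 2 : ℝ) ^ n) • x n i) ≤
        A fun i => ∑' n : ℕ, ((1 / 2 : ℝ) ^ n) • x n i := by
      refine hA.mono (fun i => smul_nonneg (by positivity) (hx0 n i)) fun i => ?_
      exact (hs i).le_tsum n fun k _ => smul_nonneg (by positivity) (hx0 k i)
    rw [A.map_smul_univ (fun _ => (1 / 2 : ℝ) ^ n) (x n)] at h1
    simp only [Finset.prod_const, Finset.card_univ, Fintype.card_fin, smul_eq_mul] at h1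
    have h2 : (n : ℝ) < ((1 / 2 : ℝ) ^ n) ^ m * A (x n) := by
      calc (n : ℝ) = ((1 / 2 : ℝ) ^ n) ^ m * ((n : ℝ) * (2 ^ n) ^ m) := by
            rw [mul_left_comm, ← mul_pow, ← mul_pow]; norm_num
        _ < _ := mul_lt_mul_of_pos_left (hx2 n) (by positivity)
    linarith
  have hC0 : 0 ≤ C := (hA 0 fun _ => le_rfl).trans (hC 0 (fun _ => le_rfl) (by simp))
  refine ⟨C, hC0, fun x => (hA.abs_le x).trans ?_⟩
  have e : (fun i => |x i|) = fun i => ‖x i‖ • (‖x i‖⁻¹ • |x i|) := by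
    ext i
    rcases eq_or_ne (x i) 0 with h | h
    · simp [h]
    · rw [smul_smul, mul_inv_cancel₀ (norm_ne_zero_iff.2 h), one_smul]
  rw [e, A.map_smul_univ (fun i => ‖x i‖) fun i => ‖x i‖⁻¹ • |x i|, smul_eq_mul, mul_comm]
  refine mul_le_mul_of_nonneg_right (hC _ (fun i => smul_nonneg (by positivity) (abs_nonneg _))
    fun i => ?_) (Finset.prod_nonneg fun i _ => norm_nonneg _)
  rw [norm_smul, norm_inv, norm_norm, norm_abs_eq_norm]
  exact inv_mul_le_one_of_le₀ le_rfl (norm_nonneg _)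

theorem RegForm.bounded (T : RegForm m E) : ∃ C : ℝ, 0 ≤ C ∧ ∀ x, ‖T.form x‖ ≤ C * ∏ i, ‖x i‖ := by
  obtain ⟨A, B, hA, hB, h⟩ := T.2
  obtain ⟨a, ha0, ha⟩ := hA.bounded
  obtain ⟨b, hb0, hb⟩ := hB.bounded
  refine ⟨a + b, add_nonneg ha0 hb0, fun x => ?_⟩
  change ‖T.1 x‖ ≤ _
  rw [h, add_mul]
  exact (norm_sub_le _ _).trans (add_le_add (ha x) (hb x))

/-- A regular form, viewed as a continuous multilinear form; this gives access to the
usual norm of continuous multilinear forms. -/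
def RegForm.toContinuous (T : RegForm m E) : ContinuousMultilinearMap ℝ (fun _ : Fin m => E) ℝ :=
  { T.form with
    cont := by
      obtain ⟨C, -, hC⟩ := T.bounded
      exact T.form.continuous_of_bound C hC }

/-- The regular norm `‖T‖_r = ‖ |T| ‖`. -/
noncomputable instance : Norm (RegForm m E) := ⟨fun T => ‖(|T|).toContinuous‖⟩

theorem RegForm.norm_def (T : RegForm m E) : ‖T‖ = ‖(|T|).toContinuous‖ := rfl

theorem RegForm.core : NormedSpace.Core ℝ (RegForm m E) := by
  refine coreOfAbs (fun T => ‖T.toContinuous‖) RegForm.norm_def (fun _ => norm_nonneg _) ?_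
    (fun T S => norm_add_le T.toContinuous S.toContinuous) (fun c T hc => ?_) fun T _ h => ?_
  · intro T S hT hTS
    refine ContinuousMultilinearMap.opNorm_le_bound (norm_nonneg _) fun x => ?_
    change |T.form x| ≤ _
    have hS := S.toContinuous.le_opNorm fun i => |x i|
    simp only [norm_abs_eq_norm] at hS
    calc |T.form x| ≤ T.form (fun i => |x i|) := (RegForm.nonneg_iff.1 hT).abs_le x
      _ ≤ S.form (fun i => |x i|) := RegForm.le_iff.1 hTS _ fun i => abs_nonneg _
      _ ≤ _ := (le_abs_self _).trans hS
  · calc ‖(c • T).toContinuous‖ = ‖c • T.toContinuous‖ := rfl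
      _ = c * ‖T.toContinuous‖ := by rw [norm_smul, Real.norm_of_nonneg hc]
  · apply RegForm.form_injective
    ext x
    exact DFunLike.congr_fun (norm_eq_zero.1 h) x

noncomputable instance : NormedAddCommGroup (RegForm m E) := .ofCore RegForm.core

noncomputable instance : NormedSpace ℝ (RegForm m E) := .ofCore RegForm.core

end Continuity

section Polynomials

variable {m : ℕ} {E : Type*} [AddCommGroup E] [Module ℝ E]

/-- `A` is a symmetric `m`-linear form associated to `P`, that is, `P x = A (x, ..., x)`.
The functions `P` having one are the `m`-homogeneous polynomials, and it is then unique. -/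
def IsAssociated (P : E → ℝ) (A : MultilinearMap ℝ (fun _ : Fin m => E) ℝ) : Prop :=
  IsSymmetric A ∧ ∀ x, P x = A fun _ => x

theorem sum_sg {f : Fin m → Fin m} :
    ∑ ε : Fin m → Bool, (∏ i, sg (ε i)) * ∏ k, sg (ε (f k)) =
      if Bijective f then (2 : ℝ) ^ m else 0 := by
  split_ifs with h
  · have : ∀ ε : Fin m → Bool, (∏ i, sg (ε i)) * ∏ k, sg (ε (f k)) = 1 := by
      intro ε
      rw [h.prod_comp (fun i => sg (ε i)), ← Finset.prod_mul_distrib]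
      refine Finset.prod_eq_one fun i _ => ?_
      cases ε i <;> simp [sg]
    simp [this]
  · have hs : ¬ Surjective f := fun hs => h (Finite.surjective_iff_bijective.1 hs)
    simp only [Surjective, not_forall, not_exists] at hs
    obtain ⟨i, hi⟩ := hs
    set g : (Fin m → Bool) → ℝ := fun ε => (∏ i, sg (ε i)) * ∏ k, sg (ε (f k)) with hg
    have hflip : ∀ ε, g (flip i ε) = -g ε := by
      intro ε
      simp only [hg]
      rw [← Finset.mul_prod_erase _ _ (Finset.mem_univ i),
        ← Finset.mul_prod_erase _ (fun j => sg (ε j)) (Finset.mem_univ i)]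
      have e2 : ∏ j ∈ Finset.univ.erase i, sg (flip i ε j) =
          ∏ j ∈ Finset.univ.erase i, sg (ε j) :=
        Finset.prod_congr rfl fun j hj => by rw [flip, update_of_ne (Finset.ne_of_mem_erase hj)]
      have e3 : ∏ k, sg (flip i ε (f k)) = ∏ k, sg (ε (f k)) :=
        Finset.prod_congr rfl fun k _ => by rw [flip, update_of_ne (hi k)]
      have e4 : sg (flip i ε i) = -sg (ε i) := by
        rw [flip, update_self]
        cases ε i <;> simp [sg]
      rw [e2, e3, e4]
      ring
    have h1 : ∑ ε, g ε = ∑ ε, g (flip i ε) := (Equiv.sum_comp (flip_flip i).toPerm g).symm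
    simp only [hflip, Finset.sum_neg_distrib] at h1
    linarith

/-- Polarization: a symmetric form is determined by its values on the diagonal. -/
theorem IsSymmetric.eq_zero {A : MultilinearMap ℝ (fun _ : Fin m => E) ℝ} (hA : IsSymmetric A)
    (h : ∀ x, A (fun _ => x) = 0) : A = 0 := by
  ext x
  have h1 : ∀ ε : Fin m → Bool, (0 : ℝ) =
      ∑ f : Fin m → Fin m, (∏ k, sg (ε (f k))) * A (fun k => x (f k)) := by
    intro ε
    rw [← h (∑ j, sg (ε j) • x j), A.map_sum fun _ j => sg (ε j) • x j]
    refine Finset.sum_congr rfl fun f _ => ?_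
    rw [A.map_smul_univ (fun k => sg (ε (f k))) fun k => x (f k), smul_eq_mul]
  have h2 : (0 : ℝ) = ∑ f : Fin m → Fin m,
      (if Bijective f then (2 : ℝ) ^ m else 0) * A (fun k => x (f k)) := by
    calc (0 : ℝ) = ∑ ε : Fin m → Bool, (∏ i, sg (ε i)) * 0 := by simp
      _ = ∑ ε : Fin m → Bool, ∑ f : Fin m → Fin m,
          (∏ i, sg (ε i)) * ((∏ k, sg (ε (f k))) * A (fun k => x (f k))) := by
        refine Finset.sum_congr rfl fun ε _ => ?_
        rw [← Finset.mul_sum, ← h1]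
      _ = _ := by
        rw [Finset.sum_comm]
        refine Finset.sum_congr rfl fun f _ => ?_
        rw [← sum_sg, Finset.sum_mul]
        exact Finset.sum_congr rfl fun ε _ => by ring
  have h3 : ∀ f : Fin m → Fin m, (if Bijective f then (2 : ℝ) ^ m else 0) * A (fun k => x (f k)) =
      (if Bijective f then (2 : ℝ) ^ m else 0) * A x := by
    intro f
    split_ifs with hf
    · rw [← hA (Equiv.ofBijective f hf) x]
      rfl
    · simp
  rw [Finset.sum_congr rfl fun f _ => h3 f, ← Finset.sum_mul] at h2
  have h4 : 0 < ∑ f : Fin m → Fin m, (if Bijective f then (2 : ℝ) ^ m else 0) :=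
    Finset.sum_pos' (fun f _ => by split_ifs <;> positivity)
      ⟨id, Finset.mem_univ _, by simp⟩
  simpa using (mul_eq_zero.1 h2.symm).resolve_left h4.ne'

theorem IsAssociated.add {P Q : E → ℝ} {A B : MultilinearMap ℝ (fun _ : Fin m => E) ℝ}
    (hA : IsAssociated P A) (hB : IsAssociated Q B) : IsAssociated (P + Q) (A + B) :=
  ⟨fun σ x => by simp [hA.1 σ x, hB.1 σ x], fun x => by simp [hA.2 x, hB.2 x]⟩

theorem IsAssociated.smul {P : E → ℝ} {A : MultilinearMap ℝ (fun _ : Fin m => E) ℝ}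
    (hA : IsAssociated P A) (c : ℝ) : IsAssociated (c • P) (c • A) :=
  ⟨fun σ x => by simp [hA.1 σ x], fun x => by simp [hA.2 x]⟩

theorem IsAssociated.sub {P Q : E → ℝ} {A B : MultilinearMap ℝ (fun _ : Fin m => E) ℝ}
    (hA : IsAssociated P A) (hB : IsAssociated Q B) : IsAssociated (P - Q) (A - B) :=
  ⟨fun σ x => by simp [hA.1 σ x, hB.1 σ x], fun x => by simp [hA.2 x, hB.2 x]⟩

theorem IsAssociated.neg {P : E → ℝ} {A : MultilinearMap ℝ (fun _ : Fin m => E) ℝ}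
    (hA : IsAssociated P A) : IsAssociated (-P) (-A) :=
  ⟨fun σ x => by simp [hA.1 σ x], fun x => by simp [hA.2 x]⟩

theorem IsAssociated.unique {P : E → ℝ} {A B : MultilinearMap ℝ (fun _ : Fin m => E) ℝ}
    (hA : IsAssociated P A) (hB : IsAssociated P B) : A = B := by
  have h := hA.sub hB
  rw [sub_self] at h
  exact sub_eq_zero.1 (h.1.eq_zero fun x => (h.2 x).symm)

variable [Lattice E] [IsOrderedAddMonoid E] [IsOrderedModule ℝ E]

variable (m) in
/-- An `m`-homogeneous polynomial is positive if its associated symmetric form is positive. -/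
def IsPosPoly (P : E → ℝ) : Prop :=
  ∃ A : MultilinearMap ℝ (fun _ : Fin m => E) ℝ, IsAssociated P A ∧ IsPositive A

theorem IsPosPoly.add {P Q : E → ℝ} (hP : IsPosPoly m P) (hQ : IsPosPoly m Q) :
    IsPosPoly m (P + Q) := by
  obtain ⟨A, hA, hA'⟩ := hP
  obtain ⟨B, hB, hB'⟩ := hQ
  exact ⟨A + B, hA.add hB, hA'.add hB'⟩

theorem IsPosPoly.smul {P : E → ℝ} (hP : IsPosPoly m P) {c : ℝ} (hc : 0 ≤ c) :
    IsPosPoly m (c • P) := by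
  obtain ⟨A, hA, hA'⟩ := hP
  exact ⟨c • A, hA.smul c, hA'.smul hc⟩

theorem IsPosPoly.zero : IsPosPoly m (0 : E → ℝ) :=
  ⟨0, ⟨fun _ _ => rfl, fun _ => rfl⟩, fun _ _ => le_rfl⟩

variable (m) in
/-- An `m`-homogeneous polynomial is regular if it is the difference of two positive ones. -/
def IsRegPoly (P : E → ℝ) : Prop :=
  ∃ Q R : E → ℝ, IsPosPoly m Q ∧ IsPosPoly m R ∧ P = Q - R

variable (m E) in
/-- The vector space of regular `m`-homogeneous polynomials. -/
def regPolySubmodule : Submodule ℝ (E → ℝ) where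
  carrier := {P | IsRegPoly m P}
  zero_mem' := ⟨0, 0, .zero, .zero, by simp⟩
  add_mem' := by
    rintro _ _ ⟨A, B, hA, hB, rfl⟩ ⟨C, D, hC, hD, rfl⟩
    exact ⟨A + C, B + D, hA.add hC, hB.add hD, by abel⟩
  smul_mem' := by
    rintro c _ ⟨A, B, hA, hB, rfl⟩
    rcases le_total 0 c with hc | hc
    · exact ⟨c • A, c • B, hA.smul hc, hB.smul hc, smul_sub _ _ _⟩
    · exact ⟨(-c) • B, (-c) • A, hB.smul (neg_nonneg.2 hc), hA.smul (neg_nonneg.2 hc), by module⟩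

variable (m E) in
/-- The space of regular `m`-homogeneous polynomials on `E`, with its order and its regular
norm below. -/
def RegPoly : Type _ := regPolySubmodule m E

noncomputable instance : AddCommGroup (RegPoly m E) :=
  inferInstanceAs (AddCommGroup (regPolySubmodule m E))

noncomputable instance : Module ℝ (RegPoly m E) :=
  inferInstanceAs (Module ℝ (regPolySubmodule m E))

/-- The underlying function. -/
def RegPoly.fn (P : RegPoly m E) : E → ℝ := P.1

theorem RegPoly.fn_injective : Injective (RegPoly.fn (m := m) (E := E)) := Subtype.val_injective

/-- `P ≤ Q` if `Q - P` is a positive polynomial. -/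
instance : PartialOrder (RegPoly m E) where
  le P Q := IsPosPoly m (Q.fn - P.fn)
  le_refl P := by rw [sub_self]; exact .zero
  le_trans _ _ _ h₁ h₂ := by
    have := h₁.add h₂
    rwa [sub_add_sub_cancel'] at this
  le_antisymm P Q h₁ h₂ := by
    obtain ⟨A, hA, hA'⟩ := h₁
    obtain ⟨B, hB, hB'⟩ := h₂
    have e : A = -B := by
      refine hA.unique ?_
      have := hB.neg
      rwa [neg_sub] at this
    have hA0 : A = 0 := by
      refine ext_of_positive fun x hx => le_antisymm ?_ (hA' x hx)
      rw [e]
      simpa using hB' x hx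
    refine RegPoly.fn_injective (funext fun x => ?_)
    have := hA.2 x
    rw [hA0] at this
    exact (sub_eq_zero.1 this).symm

theorem RegPoly.le_def {P Q : RegPoly m E} : P ≤ Q ↔ IsPosPoly m (Q.fn - P.fn) := Iff.rfl

theorem RegPoly.nonneg_iff {P : RegPoly m E} : 0 ≤ P ↔ IsPosPoly m P.fn := by
  rw [RegPoly.le_def, show (0 : RegPoly m E).fn = 0 from rfl, sub_zero]

instance : IsOrderedAddMonoid (RegPoly m E) where
  add_le_add_left P Q h R := by
    change IsPosPoly m ((Q.fn + R.fn) - (P.fn + R.fn))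
    rw [add_sub_add_right_eq_sub]
    exact h

instance : IsOrderedModule ℝ (RegPoly m E) :=
  .of_smul_nonneg fun _ hc _ hP => RegPoly.nonneg_iff.2 ((RegPoly.nonneg_iff.1 hP).smul hc)

/-- The regular polynomials are a vector lattice. -/
noncomputable instance : Lattice (RegPoly m E) :=
  latticeOfModulus fun P => by
    obtain ⟨_, _, ⟨A, hA, hA'⟩, ⟨B, hB, hB'⟩, hP⟩ := P.2
    have hT : IsAssociated P.fn (A - B) := by
      have := hA.sub hB
      rwa [← hP] at this
    obtain ⟨S, hS⟩ := RegForm.dominated ⟨A - B, A, B, hA', hB', rfl⟩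
    obtain ⟨M, hM₁, hM₂⟩ := exists_modulus hS
    change ∀ x, (∀ i, 0 ≤ x i) → |(A - B) x| ≤ M x at hM₁
    change ∀ R : MultilinearMap ℝ (fun _ : Fin m => E) ℝ,
      (∀ x, (∀ i, 0 ≤ x i) → |(A - B) x| ≤ R x) → ∀ x, (∀ i, 0 ≤ x i) → M x ≤ R x at hM₂
    have hMpos : IsPositive M := fun x hx => (abs_nonneg _).trans (hM₁ x hx)
    have hle : ∀ (σ : Equiv.Perm (Fin m)) (x : Fin m → E), (∀ i, 0 ≤ x i) →
        M x ≤ M fun i => x (σ i) := fun σ x hx =>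
      hM₂ (M.domDomCongr σ) (fun y hy => by
        rw [← hT.1 σ y]
        exact hM₁ _ fun i => hy (σ i)) x hx
    have hMsymm : IsSymmetric M := by
      intro σ x
      have : M.domDomCongr σ = M := ext_of_positive fun y hy => by
        refine le_antisymm ?_ (hle σ y hy)
        have := hle σ⁻¹ (fun i => y (σ i)) fun i => hy (σ i)
        simpa using this
      exact MultilinearMap.congr_fun this x
    have hMa : IsAssociated (fun x => M fun _ => x) M := ⟨hMsymm, fun _ => rfl⟩
    have hMr : IsRegPoly m (fun x => M fun _ => x) :=
      ⟨_, 0, ⟨M, hMa, hMpos⟩, .zero, (sub_zero _).symm⟩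
    refine ⟨⟨_, hMr⟩, ?_, ?_⟩
    · rintro Q (rfl | rfl)
      · exact ⟨_, hMa.sub hT, fun x hx => sub_nonneg.2 ((le_abs_self _).trans (hM₁ x hx))⟩
      · refine ⟨M - -(A - B), hMa.sub hT.neg, fun x hx => ?_⟩
        exact sub_nonneg.2 ((neg_le_abs _).trans (hM₁ x hx))
    · intro Q hQ
      obtain ⟨C, hC, hC'⟩ := hQ (Set.mem_insert _ _)
      obtain ⟨D, hD, hD'⟩ := hQ (Set.mem_insert_of_mem _ rfl)
      have hR : IsAssociated Q.fn (C + (A - B)) := by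
        have := hC.add hT
        rwa [sub_add_cancel] at this
      have eD : D = (C + (A - B)) + (A - B) := by
        refine hD.unique ?_
        have := hR.add hT
        rwa [show Q.fn + P.fn = Q.fn - (-P).fn from (sub_neg_eq_add Q.fn P.fn).symm] at this
      refine ⟨_, hR.sub hMa, fun x hx => sub_nonneg.2 (hM₂ _ (fun y hy => ?_) x hx)⟩
      have c := hC' y hy
      have d := hD' y hy
      rw [eD, add_apply] at d
      rw [add_apply] at d ⊢
      exact _root_.abs_le.2 ⟨by linarith, by linarith⟩

end Polynomials

section PolynomialNorm

variable {m : ℕ} {E : Type*} [NormedAddCommGroup E] [NormedSpace ℝ E] [Lattice E]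
  [IsOrderedAddMonoid E] [IsOrderedModule ℝ E] [HasSolidNorm E] [CompleteSpace E]

variable (m) in
/-- The usual norm of an `m`-homogeneous polynomial, the least `c ≥ 0` such that
`|P x| ≤ c ‖x‖ ^ m` for all `x`. -/
noncomputable def polyNorm (P : E → ℝ) : ℝ := sInf {c | 0 ≤ c ∧ ∀ x, |P x| ≤ c * ‖x‖ ^ m}

theorem polyNorm_nonneg (P : E → ℝ) : 0 ≤ polyNorm m P := Real.sInf_nonneg fun _ h => h.1

theorem polyNorm_le {P : E → ℝ} {c : ℝ} (hc : 0 ≤ c) (h : ∀ x, |P x| ≤ c * ‖x‖ ^ m) :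
    polyNorm m P ≤ c := csInf_le ⟨0, fun _ h => h.1⟩ ⟨hc, h⟩

theorem RegPoly.le_polyNorm (P : RegPoly m E) (x : E) : |P.fn x| ≤ polyNorm m P.fn * ‖x‖ ^ m := by
  have hne : {c | 0 ≤ c ∧ ∀ x, |P.fn x| ≤ c * ‖x‖ ^ m}.Nonempty := by
    obtain ⟨_, _, ⟨A, hA, hA'⟩, ⟨B, hB, hB'⟩, hP⟩ := P.2
    obtain ⟨a, ha0, ha⟩ := hA'.bounded
    obtain ⟨b, hb0, hb⟩ := hB'.bounded
    refine ⟨a + b, add_nonneg ha0 hb0, fun x => ?_⟩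
    change ‖P.1 x‖ ≤ _
    rw [hP, Pi.sub_apply, hA.2, hB.2, add_mul]
    have h1 := ha fun _ => x
    have h2 := hb fun _ => x
    simp only [Finset.prod_const, Finset.card_univ, Fintype.card_fin] at h1 h2
    exact (norm_sub_le _ _).trans (add_le_add h1 h2)
  rcases (pow_nonneg (norm_nonneg x) m).eq_or_lt with h0 | h0
  · obtain ⟨c, -, hc⟩ := hne
    have := hc x
    rw [← h0, mul_zero] at this ⊢
    exact this
  · rw [← div_le_iff₀ h0]
    exact le_csInf hne fun c hc => (div_le_iff₀ h0).2 (hc.2 x)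

/-- The regular norm `‖P‖_r = ‖ |P| ‖`. -/
noncomputable instance : Norm (RegPoly m E) := ⟨fun P => polyNorm m (|P|).fn⟩

theorem RegPoly.norm_def (P : RegPoly m E) : ‖P‖ = polyNorm m (|P|).fn := rfl

theorem RegPoly.core : NormedSpace.Core ℝ (RegPoly m E) := by
  refine coreOfAbs (fun P => polyNorm m P.fn) RegPoly.norm_def (fun _ => polyNorm_nonneg _) ?_
    (fun P Q => ?_) (fun c P hc => ?_) fun P _ h => ?_
  · intro P Q hP hPQ
    refine polyNorm_le (polyNorm_nonneg _) fun x => ?_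
    obtain ⟨A, hA, hA'⟩ := RegPoly.nonneg_iff.1 hP
    obtain ⟨B, hB, hB'⟩ := RegPoly.le_def.1 hPQ
    have h1 := hB' (fun _ => |x|) fun _ => abs_nonneg _
    rw [← hB.2, Pi.sub_apply] at h1
    have h2 := hA'.abs_le fun _ => x
    rw [← hA.2, ← hA.2] at h2
    have h3 := Q.le_polyNorm |x|
    rw [norm_abs_eq_norm] at h3
    linarith [le_abs_self (Q.fn |x|)]
  · refine polyNorm_le (add_nonneg (polyNorm_nonneg _) (polyNorm_nonneg _)) fun x => ?_
    rw [add_mul]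
    exact (abs_add_le (P.fn x) (Q.fn x)).trans (add_le_add (P.le_polyNorm x) (Q.le_polyNorm x))
  · have le : ∀ (c : ℝ) (P : RegPoly m E), 0 ≤ c →
        polyNorm m (c • P).fn ≤ c * polyNorm m P.fn := by
      intro c P hc
      refine polyNorm_le (mul_nonneg hc (polyNorm_nonneg _)) fun x => ?_
      change |c * P.fn x| ≤ _
      rw [abs_mul, abs_of_nonneg hc, mul_assoc]
      exact mul_le_mul_of_nonneg_left (P.le_polyNorm x) hc
    refine le_antisymm (le c P hc) ?_
    rcases hc.eq_or_lt with rfl | hc'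
    · simpa using polyNorm_nonneg _
    · have := le c⁻¹ (c • P) (inv_nonneg.2 hc)
      rw [smul_smul, inv_mul_cancel₀ hc'.ne', one_smul, inv_mul_eq_div, le_div_iff₀ hc'] at this
      linarith
  · refine RegPoly.fn_injective (funext fun x => ?_)
    have := P.le_polyNorm x
    rw [h, zero_mul] at this
    exact abs_nonpos_iff.1 this

noncomputable instance : NormedAddCommGroup (RegPoly m E) := .ofCore RegPoly.core

noncomputable instance : NormedSpace ℝ (RegPoly m E) := .ofCore RegPoly.core

end PolynomialNorm

section Dual

variable {E : Type*} [NormedAddCommGroup E] [NormedSpace ℝ E] [Lattice E] [IsOrderedAddMonoid E]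

/-- The dual order: `φ ≤ ψ` if `φ x ≤ ψ x` for every `x ≥ 0`. -/
instance dualPartialOrder : PartialOrder (StrongDual ℝ E) where
  le φ ψ := ∀ x, 0 ≤ x → φ x ≤ ψ x
  le_refl _ _ _ := le_rfl
  le_trans _ _ _ h₁ h₂ x hx := (h₁ x hx).trans (h₂ x hx)
  le_antisymm φ ψ h₁ h₂ := by
    ext x
    have h : ∀ y, 0 ≤ y → φ y = ψ y := fun y hy => le_antisymm (h₁ y hy) (h₂ y hy)
    rw [← posPart_sub_negPart x, map_sub, map_sub, h _ (posPart_nonneg x), h _ (negPart_nonneg x)]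

end Dual

end RegularForms

/-! The positive Schur property climbs from `E*` to forms of every degree by currying, passes to
polynomials by polarization, and returns to `E*` through multiplication by powers of a fixed
positive functional.

Going up is an induction on the degree (`hasPSP_regForm_succ`). Let `u n` be positive and weakly
null in degree `m + 1`, and choose positive `a n` in the unit ball such that fixing the first
argument of `u n` at `a n` keeps at least half of the norm. The property in degree `m` then finishes
the step, once the curried forms are known to be weakly null. The vectors `a n` vary, so weak
continuity alone does not give this. For a positive functional `ψ` on the forms of degree `m`,
however, the functionals `a ↦ ψ (curry (u n) a)` on `E` are positive and weakly null in `E*`, hence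
norm null by the property of `E*`. This is convergence uniform on the unit ball, so it covers the
moving `a n`. Positive `ψ` suffice, because every bounded functional on a normed lattice is
dominated by a positive one (`exists_dominating`).

The other implications transfer the property back along a positive bounded operator that is bounded
below on the positive cone (`HasPSP.of_bounded_below`). From forms to polynomials the operator sends
a polynomial to its symmetric form. From forms or polynomials of degree `m ≥ 1` to `E*` it sends `f`
to the symmetrized product of `f` with `m - 1` copies of a fixed positive functional `g ≠ 0`. On the
diagonal this is `m * f x * g x ^ (m - 1)`. If `y ≥ 0` and `g y = 1`, evaluation at `|x| + y` bounds
`f |x|`, because `g` is at least `1` there (`norm_le_of_symProd_le`). -/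

namespace RegularForms

set_option linter.unusedSectionVars false

/-! ### Positive majorants of bounded functionals -/

section Domination

variable {X : Type*} [NormedAddCommGroup X] [NormedSpace ℝ X] [Lattice X]
  [IsOrderedAddMonoid X] [IsOrderedModule ℝ X] [HasSolidNorm X]

/-- Every continuous functional on a normed lattice is dominated by a positive one of no larger
norm. -/
theorem exists_dominating (φ : StrongDual ℝ X) :
    ∃ ψ : StrongDual ℝ X, (∀ x, 0 ≤ x → |φ x| ≤ ψ x) ∧ ‖ψ‖ ≤ ‖φ‖ := by
  -- A functional is a form of degree one, so the least superadditive majorant built for forms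
  -- applies to it.
  let T : MultilinearMap ℝ (fun _ : Fin 1 => X) ℝ :=
    LinearMap.compMultilinearMap φ.toLinearMap
      (MultilinearMap.ofSubsingleton ℝ X X (0 : Fin 1) LinearMap.id)
  have hT : ∀ x, T x = φ (x 0) := fun x => rfl
  -- The Riesz–Kantorovich expression for `|φ|`. Only its superadditivity is needed; additivity will
  -- come from the least majorant below it.
  let q : X → ℝ := fun x => ⨆ h : {h : X // |h| ≤ x}, φ h.1
  have hbound : ∀ x h : X, |h| ≤ x → φ h ≤ ‖φ‖ * ‖x‖ := fun x h hh =>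
    (le_abs_self _).trans ((φ.le_opNorm h).trans (mul_le_mul_of_nonneg_left
      (HasSolidNorm.solid (hh.trans (le_abs_self x))) (norm_nonneg _)))
  have hbdd : ∀ x, BddAbove (Set.range fun h : {h : X // |h| ≤ x} => φ h.1) := fun x =>
    ⟨‖φ‖ * ‖x‖, by rintro _ ⟨h, rfl⟩; exact hbound x h.1 h.2⟩
  have hne : ∀ x : X, 0 ≤ x → Nonempty {h : X // |h| ≤ x} := fun x hx => ⟨⟨0, by simpa using hx⟩⟩
  have hle : ∀ x h : X, |h| ≤ x → φ h ≤ q x := fun x h hh =>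
    le_ciSup (f := fun h : {h : X // |h| ≤ x} => φ h.1) (hbdd x) ⟨h, hh⟩
  have hqle : ∀ x, 0 ≤ x → q x ≤ ‖φ‖ * ‖x‖ := fun x hx => by
    have := hne x hx
    exact ciSup_le fun h => hbound x h.1 h.2
  have hmem : (fun x : Fin 1 → X => q (x 0)) ∈ superMajorants T := by
    refine ⟨fun x hx => abs_le'.2 ⟨?_, ?_⟩, fun x hx i a b ha hb => ?_⟩
    · exact hle _ _ (abs_of_nonneg (hx 0)).le
    · rw [hT, ← map_neg]
      exact hle _ _ (by rw [abs_neg, abs_of_nonneg (hx 0)])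
    · obtain rfl : i = 0 := Subsingleton.elim _ _
      simp only [update_self]
      have := hne a ha
      have := hne b hb
      refine ciSup_add_ciSup_le fun h k => ?_
      rw [← map_add]
      exact hle _ _ ((abs_add_le _ _).trans (add_le_add h.2 k.2))
  have hsne : (superMajorants T).Nonempty := ⟨_, hmem⟩
  -- On the cone the least majorant is additive and positively homogeneous, so it extends linearly.
  -- It lies between `|φ|` and `q`, which gives both the domination and the norm bound.
  obtain ⟨M, hM⟩ := exists_extension (leastMajorant T)
    (fun x hx i a b ha hb => leastMajorant_add hsne hx i ha hb)
    (fun x hx i c hc a ha => leastMajorant_smul hsne hx i hc ha)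
  have hdom : ∀ x : X, 0 ≤ x → |φ x| ≤ M fun _ => x := fun x hx => by
    rw [hM _ fun _ => hx]
    exact (leastMajorant_mem hsne).1 (fun _ => x) fun _ => hx
  have hMle : ∀ x : X, 0 ≤ x → (M fun _ => x) ≤ ‖φ‖ * ‖x‖ := fun x hx => by
    rw [hM _ fun _ => hx]
    exact (leastMajorant_le hmem fun _ => hx).trans (hqle x hx)
  have hMpos : IsPositive M := fun x hx => by
    rw [hM x hx]
    exact (abs_nonneg _).trans ((leastMajorant_mem hsne).1 x hx)
  let L : X →ₗ[ℝ] ℝ := (MultilinearMap.ofSubsingleton ℝ X ℝ (0 : Fin 1)).symm M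
  have hL : ∀ x, L x = M fun _ => x := fun x => rfl
  have hLb : ∀ x, ‖L x‖ ≤ ‖φ‖ * ‖x‖ := fun x => by
    have h := hMle |x| (abs_nonneg x)
    rw [norm_abs_eq_norm] at h
    exact (hMpos.abs_le fun _ => x).trans h
  exact ⟨L.mkContinuous _ hLb, hdom, L.mkContinuous_norm_le (norm_nonneg _) _⟩

/-- Weak nullity of a positive sequence may be tested on positive functionals. -/
theorem tendsto_of_tendsto_positive {u : ℕ → X} (hu : ∀ n, 0 ≤ u n)
    (h : ∀ ψ : StrongDual ℝ X, (∀ x, 0 ≤ x → 0 ≤ ψ x) → Tendsto (fun n => ψ (u n)) atTop (𝓝 0))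
    (φ : StrongDual ℝ X) : Tendsto (fun n => φ (u n)) atTop (𝓝 0) := by
  obtain ⟨ψ, hψ, -⟩ := exists_dominating φ
  exact squeeze_zero_norm (fun n => hψ _ (hu n))
    (h ψ fun x hx => (abs_nonneg _).trans (hψ x hx))

end Domination

/-! ### The regular norm as a lattice norm -/

section FormNorm

variable {m : ℕ} {E : Type*} [NormedAddCommGroup E] [NormedSpace ℝ E] [Lattice E]
  [IsOrderedAddMonoid E] [IsOrderedModule ℝ E] [HasSolidNorm E] [CompleteSpace E]

/-- Both `|T| - T` and `|T| + T` are positive, so each is bounded at `x` by its value at the moduli.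
Half their difference is `T`, and the terms `T |x|` cancel when the two bounds are added. -/
theorem RegForm.abs_form_le (T : RegForm m E) (x : Fin m → E) :
    |T.form x| ≤ (|T|).form fun i => |x i| := by
  have h1 : IsPositive ((|T|).form - T.form) := (le_abs_self T : T ≤ |T|)
  have h2 : IsPositive ((|T|).form - -T.form) := (neg_le_abs T : -T ≤ |T|)
  have e1 := abs_le.1 (h1.abs_le x)
  have e2 := abs_le.1 (h2.abs_le x)
  simp only [sub_apply, neg_apply] at e1 e2
  exact abs_le.2 ⟨by linarith [e1.1, e1.2, e2.1, e2.2], by linarith [e1.1, e1.2, e2.1, e2.2]⟩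

theorem RegForm.form_abs_le_norm (T : RegForm m E) (x : Fin m → E) :
    |(|T|).form x| ≤ ‖T‖ * ∏ i, ‖x i‖ := (|T|).toContinuous.le_opNorm x

theorem RegForm.form_le_norm (T : RegForm m E) (x : Fin m → E) :
    |T.form x| ≤ ‖T‖ * ∏ i, ‖x i‖ := by
  have h := T.form_abs_le_norm fun i => |x i|
  simp only [norm_abs_eq_norm] at h
  exact (T.abs_form_le x).trans ((le_abs_self _).trans h)

/-- A bound for the regular norm, by means of a dominating form. -/
theorem RegForm.norm_le {T S : RegForm m E} {C : ℝ} (hC : 0 ≤ C)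
    (hTS : ∀ x, (∀ i, 0 ≤ x i) → |T.form x| ≤ S.form x)
    (hS : ∀ x, (∀ i, 0 ≤ x i) → S.form x ≤ C * ∏ i, ‖x i‖) : ‖T‖ ≤ C := by
  have h : |T| ≤ S := abs_le'.2 ⟨RegForm.le_iff.2 fun x hx => (le_abs_self _).trans (hTS x hx),
    RegForm.le_iff.2 fun x hx => (neg_le_abs _).trans (hTS x hx)⟩
  refine ContinuousMultilinearMap.opNorm_le_bound hC fun x => ?_
  have h0 := (RegForm.nonneg_iff.1 (abs_nonneg T)).abs_le x
  have h1 := RegForm.le_iff.1 h (fun i => |x i|) fun i => abs_nonneg _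
  have h2 := hS (fun i => |x i|) fun i => abs_nonneg _
  simp only [norm_abs_eq_norm] at h2
  exact h0.trans (h1.trans h2)

theorem RegForm.norm_le_of_nonneg {T : RegForm m E} (hT : 0 ≤ T) {C : ℝ} (hC : 0 ≤ C)
    (h : ∀ x, (∀ i, 0 ≤ x i) → T.form x ≤ C * ∏ i, ‖x i‖) : ‖T‖ ≤ C :=
  RegForm.norm_le hC (fun x hx => (abs_of_nonneg (RegForm.nonneg_iff.1 hT x hx)).le) h

/-- This makes `RegForm m E` a normed lattice, so that functionals on it have positive majorants
too; the induction on the degree relies on this. -/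
instance : HasSolidNorm (RegForm m E) where
  solid T S h := by
    refine RegForm.norm_le (S := |S|) (norm_nonneg S) (fun x hx => ?_) fun x hx =>
      (le_abs_self _).trans (S.form_abs_le_norm x)
    have h1 := T.abs_form_le x
    simp only [abs_of_nonneg (hx _)] at h1
    exact h1.trans (RegForm.le_iff.1 h x hx)

end FormNorm

/-! ### Induction on the degree by fixing one argument -/

section Curry

variable {m : ℕ} {E : Type*} [NormedAddCommGroup E] [NormedSpace ℝ E] [Lattice E]
  [IsOrderedAddMonoid E] [IsOrderedModule ℝ E] [HasSolidNorm E] [CompleteSpace E]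

theorem cons_nonneg {a : E} (ha : 0 ≤ a) {x : Fin m → E} (hx : ∀ i, 0 ≤ x i) (i : Fin (m + 1)) :
    0 ≤ (Fin.cons a x : Fin (m + 1) → E) i := by
  cases i using Fin.cases with
  | zero => exact ha
  | succ i => exact hx i

theorem IsPositive.curryLeft {A : MultilinearMap ℝ (fun _ : Fin (m + 1) => E) ℝ}
    (hA : IsPositive A) {a : E} (ha : 0 ≤ a) : IsPositive (A.curryLeft a) :=
  fun _ hx => hA _ (cons_nonneg ha hx)

/-- Multiply out `(B - C)` at `a⁺ - a⁻` and collect the terms of equal sign. -/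
theorem IsRegular.curryLeft {A : MultilinearMap ℝ (fun _ : Fin (m + 1) => E) ℝ}
    (hA : IsRegular A) (a : E) : IsRegular (A.curryLeft a) := by
  obtain ⟨B, C, hB, hC, rfl⟩ := hA
  refine ⟨B.curryLeft a⁺ + C.curryLeft a⁻, B.curryLeft a⁻ + C.curryLeft a⁺,
    (hB.curryLeft (posPart_nonneg a)).add (hC.curryLeft (negPart_nonneg a)),
    (hB.curryLeft (negPart_nonneg a)).add (hC.curryLeft (posPart_nonneg a)), ?_⟩
  have e : (B - C).curryLeft a = B.curryLeft a - C.curryLeft a := rfl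
  rw [e]
  nth_rewrite 1 2 [← posPart_sub_negPart a]
  rw [map_sub, map_sub]
  abel

/-- Fixing the first argument of a regular form. -/
noncomputable def RegForm.curry : RegForm (m + 1) E →L[ℝ] E →L[ℝ] RegForm m E :=
  LinearMap.mkContinuous₂
    (LinearMap.mk₂ ℝ (fun (T : RegForm (m + 1) E) (a : E) =>
        (⟨T.form.curryLeft a, IsRegular.curryLeft T.2 a⟩ : RegForm m E))
      (fun _ _ _ => rfl) (fun _ _ _ => rfl)
      (fun T a b => RegForm.form_injective (T.form.curryLeft.map_add a b))
      (fun c T a => RegForm.form_injective (T.form.curryLeft.map_smul c a)))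
    1 fun T a => by
      rw [one_mul]
      -- The regular norm requires a dominating form, not just a pointwise bound on the curried
      -- form; currying `|T|` at `|a|` provides one.
      refine RegForm.norm_le (S := ⟨(|T|).form.curryLeft |a|, IsRegular.curryLeft (|T|).2 |a|⟩)
        (by positivity) (fun x hx => ?_) fun x hx => ?_
      · refine (T.abs_form_le (Fin.cons a x)).trans (le_of_eq ?_)
        change (|T|).form _ = (|T|).form (Fin.cons |a| x)
        congr 1
        ext i
        cases i using Fin.cases with
        | zero => rfl
        | succ i => exact abs_of_nonneg (hx i)
      · refine ((le_abs_self _).trans (T.form_abs_le_norm (Fin.cons |a| x))).trans (le_of_eq ?_)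
        simp [Fin.prod_univ_succ, mul_assoc, norm_abs_eq_norm]

theorem RegForm.curry_form (T : RegForm (m + 1) E) (a : E) (x : Fin m → E) :
    (RegForm.curry T a).form x = T.form (Fin.cons a x) := rfl

theorem RegForm.curry_nonneg {T : RegForm (m + 1) E} (hT : 0 ≤ T) {a : E} (ha : 0 ≤ a) :
    0 ≤ RegForm.curry T a :=
  RegForm.nonneg_iff.2 ((RegForm.nonneg_iff.1 hT).curryLeft ha)

/-- A positive form almost attains half of its norm at a positive vector. -/
theorem RegForm.exists_norm_le_curry {T : RegForm (m + 1) E} (hT : 0 ≤ T) :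
    ∃ a : E, 0 ≤ a ∧ ‖a‖ ≤ 1 ∧ ‖T‖ ≤ 2 * ‖RegForm.curry T a‖ := by
  rcases (norm_nonneg T).eq_or_lt with h0 | h0
  · exact ⟨0, le_rfl, by simp, by rw [← h0]; positivity⟩
  by_contra! h
  -- If every positive `a` in the unit ball gave less than half the norm, homogeneity in the first
  -- argument would halve the norm of `T` itself. Any factor greater than `1` could replace `2`.
  have key : ‖T‖ ≤ ‖T‖ / 2 := by
    refine RegForm.norm_le_of_nonneg hT (by positivity) fun x hx => ?_
    have h1 : ‖RegForm.curry T (x 0)‖ ≤ ‖T‖ / 2 * ‖x 0‖ := by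
      rcases (norm_nonneg (x 0)).eq_or_lt with hz | hz
      · rw [norm_eq_zero.1 hz.symm]
        simp
      · have := h (‖x 0‖⁻¹ • x 0) (smul_nonneg (by positivity) (hx 0))
          (by rw [norm_smul, norm_inv, norm_norm, inv_mul_cancel₀ hz.ne'])
        rw [map_smul, norm_smul, norm_inv, norm_norm] at this
        have e : ‖RegForm.curry T (x 0)‖ =
            ‖x 0‖ * (‖x 0‖⁻¹ * ‖RegForm.curry T (x 0)‖) := by field_simp
        rw [e]
        nlinarith
    have h2 := (RegForm.curry T (x 0)).form_le_norm (Fin.tail x)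
    rw [RegForm.curry_form, Fin.cons_self_tail] at h2
    rw [Fin.prod_univ_succ, ← mul_assoc]
    refine (le_abs_self _).trans (h2.trans ?_)
    exact mul_le_mul_of_nonneg_right h1 (Finset.prod_nonneg fun i _ => norm_nonneg _)
  linarith

/-- Regular forms of degree zero are numbers. -/
theorem hasPSP_regForm_zero : HasPSP (RegForm 0 E) := by
  intro u hu h
  -- Evaluation at the only (empty) tuple; it computes the norm of a positive form.
  let φ : StrongDual ℝ (RegForm 0 E) :=
    LinearMap.mkContinuous
      { toFun := fun T => T.form 0
        map_add' := fun _ _ => rfl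
        map_smul' := fun _ _ => rfl } 1 fun T => by
      simpa using T.form_le_norm 0
  refine squeeze_zero (fun n => norm_nonneg _) (fun n => ?_) (h φ)
  have h0 : 0 ≤ (u n).form 0 := RegForm.nonneg_iff.1 (hu n) _ fun _ => le_rfl
  refine RegForm.norm_le_of_nonneg (hu n) h0 fun x _ => ?_
  rw [Subsingleton.elim x 0]
  simp [φ]

/-- The two hypotheses have different roles: that on `E*` makes the curried sequence weakly null,
and that on degree `m` turns this into norm convergence. -/
theorem hasPSP_regForm_succ (hE : HasPSP (StrongDual ℝ E)) (hm : HasPSP (RegForm m E)) :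
    HasPSP (RegForm (m + 1) E) := by
  intro u hu h
  choose a ha0 ha1 ha using fun n => RegForm.exists_norm_le_curry (hu n)
  have hv : ∀ n, 0 ≤ RegForm.curry (u n) (a n) := fun n => RegForm.curry_nonneg (hu n) (ha0 n)
  have hlim := hm (fun n => RegForm.curry (u n) (a n)) hv
    (tendsto_of_tendsto_positive hv fun ψ hψ => ?_)
  · refine squeeze_zero (fun n => norm_nonneg _) ha ?_
    simpa using hlim.const_mul 2
  · let Ψ : RegForm (m + 1) E →L[ℝ] StrongDual ℝ E :=
      (ContinuousLinearMap.compL ℝ E (RegForm m E) ℝ ψ).comp RegForm.curry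
    have hΨ : Tendsto (fun n => ‖Ψ (u n)‖) atTop (𝓝 0) :=
      hE (fun n => Ψ (u n)) (fun n x hx => hψ _ (RegForm.curry_nonneg (hu n) hx))
        fun φ => h (φ.comp Ψ)
    refine squeeze_zero_norm (fun n => ?_) hΨ
    exact (Ψ (u n)).unit_le_opNorm (a n) (ha1 n)

/-- The positive Schur property passes from the dual to the regular forms. -/
theorem hasPSP_regForm (hE : HasPSP (StrongDual ℝ E)) (m : ℕ) : HasPSP (RegForm m E) := by
  induction m with
  | zero => exact hasPSP_regForm_zero
  | succ m ih => exact hasPSP_regForm_succ hE ih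

end Curry

/-- The positive Schur property is inherited through a positive bounded operator that is bounded
below on the positive cone. -/
theorem HasPSP.of_bounded_below {X Y : Type*} [NormedAddCommGroup X] [NormedSpace ℝ X]
    [PartialOrder X] [NormedAddCommGroup Y] [NormedSpace ℝ Y] [PartialOrder Y] (hY : HasPSP Y)
    (L : X →L[ℝ] Y) (hL : ∀ x, 0 ≤ x → 0 ≤ L x) (K : ℝ) (hK : ∀ x, 0 ≤ x → ‖x‖ ≤ K * ‖L x‖) :
    HasPSP X := by
  intro u hu h
  have := (hY (fun n => L (u n)) (fun n => hL _ (hu n)) fun φ => h (φ.comp L)).const_mul K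
  rw [mul_zero] at this
  exact squeeze_zero (fun n => norm_nonneg _) (fun n => hK _ (hu n)) this

/-! ### Regular polynomials and their symmetric forms -/

section Polarization

variable {m : ℕ} {E : Type*} [NormedAddCommGroup E] [NormedSpace ℝ E] [Lattice E]
  [IsOrderedAddMonoid E] [IsOrderedModule ℝ E] [HasSolidNorm E] [CompleteSpace E]

theorem RegPoly.exists_polar (P : RegPoly m E) :
    ∃ T : RegForm m E, IsAssociated P.fn T.form := by
  obtain ⟨_, _, ⟨A, hA, hA'⟩, ⟨B, hB, hB'⟩, hP⟩ := P.2
  refine ⟨⟨A - B, A, B, hA', hB', rfl⟩, ?_⟩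
  change IsAssociated P.1 _
  rw [hP]
  exact hA.sub hB

/-- The symmetric form associated to a regular polynomial. -/
noncomputable def RegPoly.polar : RegPoly m E →ₗ[ℝ] RegForm m E where
  toFun P := P.exists_polar.choose
  -- The chosen form depends linearly on the polynomial because the associated symmetric form is
  -- unique.
  map_add' P Q := RegForm.form_injective <| (P + Q).exists_polar.choose_spec.unique
    (P.exists_polar.choose_spec.add Q.exists_polar.choose_spec)
  map_smul' c P := RegForm.form_injective <| (c • P).exists_polar.choose_spec.unique
    (P.exists_polar.choose_spec.smul c)

theorem RegPoly.isAssociated_polar (P : RegPoly m E) : IsAssociated P.fn (polar P).form :=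
  P.exists_polar.choose_spec

theorem RegPoly.polar_nonneg {P : RegPoly m E} (hP : 0 ≤ P) : 0 ≤ polar P := by
  obtain ⟨A, hA, hA'⟩ := RegPoly.nonneg_iff.1 hP
  rw [RegForm.nonneg_iff, P.isAssociated_polar.unique hA]
  exact hA'

theorem RegPoly.polar_mono {P Q : RegPoly m E} (h : P ≤ Q) : polar P ≤ polar Q := by
  rw [← sub_nonneg, ← map_sub]
  exact polar_nonneg (sub_nonneg.2 h)

theorem RegPoly.fn_le_norm {P : RegPoly m E} (hP : 0 ≤ P) (x : E) :
    |P.fn x| ≤ ‖P‖ * ‖x‖ ^ m := by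
  rw [RegPoly.norm_def, abs_of_nonneg hP]
  exact P.le_polyNorm x

/-- A bound for the regular norm, by means of a dominating polynomial. -/
theorem RegPoly.norm_le {P Q : RegPoly m E} {C : ℝ} (hC : 0 ≤ C) (h₁ : P ≤ Q) (h₂ : -P ≤ Q)
    (hQ : ∀ x, 0 ≤ x → Q.fn x ≤ C * ‖x‖ ^ m) : ‖P‖ ≤ C := by
  have h : |P| ≤ Q := abs_le'.2 ⟨h₁, h₂⟩
  refine polyNorm_le hC fun x => ?_
  have e0 := (RegForm.nonneg_iff.1 (polar_nonneg (abs_nonneg P))).abs_le fun _ => x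
  have e1 := RegForm.le_iff.1 (polar_mono h) (fun _ => |x|) fun i => abs_nonneg _
  have e2 := hQ |x| (abs_nonneg _)
  rw [← (|P|).isAssociated_polar.2, ← (|P|).isAssociated_polar.2] at e0
  rw [← (|P|).isAssociated_polar.2, ← Q.isAssociated_polar.2] at e1
  rw [norm_abs_eq_norm] at e2
  exact e0.trans (e1.trans e2)

/-- The polynomial is the restriction of its form to the diagonal, so this direction costs no
polarization constant. -/
theorem RegPoly.norm_le_norm_polar {P : RegPoly m E} (hP : 0 ≤ P) : ‖P‖ ≤ ‖polar P‖ := by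
  refine RegPoly.norm_le (norm_nonneg _) le_rfl ((neg_nonpos.2 hP).trans hP) fun x _ => ?_
  have h := (polar P).form_le_norm fun _ => x
  rw [← P.isAssociated_polar.2] at h
  simp only [Finset.prod_const, Finset.card_univ, Fintype.card_fin] at h
  exact (le_abs_self _).trans h

/-- Positivity replaces the polarization formula: for positive unit vectors `y i`, each `y i` is at
most their sum, so the form at `y` is at most the polynomial at the sum. The sum has norm at most
`m`, whence `m ^ m`. -/
theorem RegPoly.polar_form_le {P : RegPoly m E} (hP : 0 ≤ P) {x : Fin m → E} (hx : ∀ i, 0 ≤ x i) :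
    (polar P).form x ≤ (m : ℝ) ^ m * ‖P‖ * ∏ i, ‖x i‖ := by
  -- A vanishing argument cannot be normalized, but there the form is zero.
  by_cases h0 : ∃ i, x i = 0
  · obtain ⟨i, hi⟩ := h0
    rw [(polar P).form.map_coord_zero i hi]
    positivity
  push Not at h0
  set y : Fin m → E := fun i => ‖x i‖⁻¹ • x i with hy
  have hy0 : ∀ i, 0 ≤ y i := fun i => smul_nonneg (by positivity) (hx i)
  have hy1 : ∀ i, ‖y i‖ = 1 := fun i => by
    rw [hy, norm_smul, norm_inv, norm_norm, inv_mul_cancel₀ (norm_ne_zero_iff.2 (h0 i))]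
  have e : x = fun i => ‖x i‖ • y i := by
    ext i
    rw [hy, smul_smul, mul_inv_cancel₀ (norm_ne_zero_iff.2 (h0 i)), one_smul]
  have h1 : (polar P).form y ≤ P.fn (∑ i, y i) := by
    rw [P.isAssociated_polar.2]
    exact (RegForm.nonneg_iff.1 (polar_nonneg hP)).mono hy0 fun i =>
      Finset.single_le_sum (fun j _ => hy0 j) (Finset.mem_univ i)
  have h2 : ‖∑ i, y i‖ ≤ m := by
    refine (norm_sum_le _ _).trans ?_
    simp [hy1]
  have h3 : (polar P).form y ≤ (m : ℝ) ^ m * ‖P‖ := by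
    refine h1.trans ((le_abs_self _).trans ((RegPoly.fn_le_norm hP _).trans ?_))
    rw [mul_comm]
    gcongr
  conv_lhs => rw [e]
  rw [(polar P).form.map_smul_univ (fun i => ‖x i‖) y, smul_eq_mul, mul_comm]
  exact mul_le_mul_of_nonneg_right h3 (Finset.prod_nonneg fun i _ => norm_nonneg _)

/-- Since `polar` is positive, `polar |P|` dominates `polar P`. This reduces the bound to the
positive polynomial `|P|`, which has the same regular norm as `P`. -/
theorem RegPoly.norm_polar_le (P : RegPoly m E) : ‖polar P‖ ≤ (m : ℝ) ^ m * ‖P‖ := by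
  refine RegForm.norm_le (S := polar |P|) (by positivity) (fun x hx => ?_) fun x hx => ?_
  · have h1 := RegForm.le_iff.1 (polar_mono (le_abs_self P)) x hx
    have h2 := RegForm.le_iff.1 (polar_mono (neg_le_abs P)) x hx
    rw [map_neg] at h2
    exact abs_le'.2 ⟨h1, h2⟩
  · have h := RegPoly.polar_form_le (abs_nonneg P) hx
    have e : ‖|P|‖ = ‖P‖ := by rw [RegPoly.norm_def, RegPoly.norm_def, abs_abs]
    rwa [e] at h

variable (m E) in
/-- The passage to the associated symmetric form, as a bounded operator. -/
noncomputable def RegPoly.polarL : RegPoly m E →L[ℝ] RegForm m E :=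
  LinearMap.mkContinuous RegPoly.polar ((m : ℝ) ^ m) RegPoly.norm_polar_le

theorem RegPoly.polarL_apply (P : RegPoly m E) : RegPoly.polarL m E P = RegPoly.polar P := rfl

theorem HasPSP.regPoly (h : HasPSP (RegForm m E)) : HasPSP (RegPoly m E) := by
  refine h.of_bounded_below (RegPoly.polarL m E) (fun P hP => ?_) 1 fun P hP => ?_
  · rw [RegPoly.polarL_apply]
    exact RegPoly.polar_nonneg hP
  · rw [RegPoly.polarL_apply, one_mul]
    exact RegPoly.norm_le_norm_polar hP

end Polarization

/-! ### Symmetrized products of two functionals -/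

section SymmetricProduct

variable {E : Type*} [AddCommGroup E] [Module ℝ E]

/-- The symmetric `m`-linear form `∑ i, f (x i) * ∏ j ≠ i, g (x j)`. -/
noncomputable def symProd (m : ℕ) (g : E →ₗ[ℝ] ℝ) :
    (E →ₗ[ℝ] ℝ) →ₗ[ℝ] MultilinearMap ℝ (fun _ : Fin m => E) ℝ :=
  -- Composing the product map with one functional per slot is multilinear in the functionals.
  -- Varying only slot `i` around the constant family `g` makes each summand, and hence the sum,
  -- linear in `f` by construction.
  LinearMap.applyₗ (MultilinearMap.mkPiAlgebra ℝ (Fin m) ℝ) ∘ₗ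
    ∑ i : Fin m, (MultilinearMap.compLinearMapMultilinear (R := ℝ) (ι := Fin m)
      (M₁ := fun _ => E) (M₁' := fun _ => ℝ) (M₂ := ℝ)).toLinearMap (fun _ => g) i

variable {m : ℕ}

theorem symProd_apply (g f : E →ₗ[ℝ] ℝ) (x : Fin m → E) :
    symProd m g f x = ∑ i, ∏ j, (if j = i then f (x j) else g (x j)) := by
  simp only [symProd, LinearMap.comp_apply, LinearMap.sum_apply, map_sum,
    sum_apply]
  refine Finset.sum_congr rfl fun i _ => ?_
  change ∏ j, update (fun _ => g) i f j (x j) = _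
  refine Finset.prod_congr rfl fun j _ => ?_
  rcases eq_or_ne j i with rfl | h
  · simp
  · simp [h]

theorem isSymmetric_symProd (g f : E →ₗ[ℝ] ℝ) : IsSymmetric (symProd m g f) := by
  intro σ x
  rw [symProd_apply, symProd_apply,
    -- Permuting the arguments turns the summand of index `i` into the one of index `σ i`.
    ← Equiv.sum_comp σ (fun i => ∏ j, if j = i then f (x j) else g (x j))]
  refine Finset.sum_congr rfl fun i _ => ?_
  rw [← Equiv.prod_comp σ (fun j => if j = σ i then f (x j) else g (x j))]
  simp

theorem symProd_diag (g f : E →ₗ[ℝ] ℝ) (x : E) :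
    (symProd m g f fun _ => x) = m * (f x * g x ^ (m - 1)) := by
  rw [symProd_apply]
  have : ∀ i : Fin m, ∏ j : Fin m, (if j = i then f x else g x) = f x * g x ^ (m - 1) := by
    intro i
    rw [← Finset.mul_prod_erase _ _ (Finset.mem_univ i), if_pos rfl,
      Finset.prod_congr rfl fun j hj => if_neg (Finset.ne_of_mem_erase hj)]
    simp
  simp [this]

theorem isPositive_symProd [PartialOrder E] {g f : E →ₗ[ℝ] ℝ} (hg : ∀ x, 0 ≤ x → 0 ≤ g x)
    (hf : ∀ x, 0 ≤ x → 0 ≤ f x) : IsPositive (symProd m g f) := by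
  intro x hx
  rw [symProd_apply]
  refine Finset.sum_nonneg fun i _ => Finset.prod_nonneg fun j _ => ?_
  split_ifs
  · exact hf _ (hx j)
  · exact hg _ (hx j)

end SymmetricProduct

/-! ### Recovering the dual from forms and polynomials -/

section Converse

variable {m : ℕ} {E : Type*} [NormedAddCommGroup E] [NormedSpace ℝ E] [Lattice E]
  [IsOrderedAddMonoid E] [IsOrderedModule ℝ E] [HasSolidNorm E] [CompleteSpace E]

theorem symProd_le (g f : StrongDual ℝ E) (x : Fin m → E) :
    symProd m g.toLinearMap f.toLinearMap x ≤ m * (‖f‖ * ‖g‖ ^ (m - 1)) * ∏ i, ‖x i‖ := by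
  rw [symProd_apply, mul_assoc, ← nsmul_eq_mul]
  refine (Finset.sum_le_card_nsmul _ _ (‖f‖ * ‖g‖ ^ (m - 1) * ∏ i, ‖x i‖) fun i _ => ?_).trans
    (by simp)
  refine (le_abs_self _).trans ?_
  rw [Finset.abs_prod, ← Finset.mul_prod_erase _ _ (Finset.mem_univ i), if_pos rfl,
    ← Finset.mul_prod_erase _ (fun i => ‖x i‖) (Finset.mem_univ i)]
  have h1 : ∏ j ∈ Finset.univ.erase i,
      |if j = i then f.toLinearMap (x j) else g.toLinearMap (x j)| ≤
      ‖g‖ ^ (m - 1) * ∏ j ∈ Finset.univ.erase i, ‖x j‖ := by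
    have e : ‖g‖ ^ (m - 1) = ∏ j ∈ Finset.univ.erase i, ‖g‖ := by simp
    rw [e, ← Finset.prod_mul_distrib]
    refine Finset.prod_le_prod (fun j _ => abs_nonneg _) fun j hj => ?_
    rw [if_neg (Finset.ne_of_mem_erase hj)]
    exact g.le_opNorm (x j)
  have h2 : |f.toLinearMap (x i)| ≤ ‖f‖ * ‖x i‖ := f.le_opNorm (x i)
  refine (mul_le_mul h2 h1 (Finset.prod_nonneg fun j _ => abs_nonneg _) (by positivity)).trans
    (le_of_eq ?_)
  ring

/-- With `ψ` a positive majorant of `f`, write `f = ψ - (ψ - f)`, a difference of positive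
functionals, and use linearity in `f`. -/
theorem isRegular_symProd {g : StrongDual ℝ E} (hg : ∀ x, 0 ≤ x → 0 ≤ g x)
    (f : StrongDual ℝ E) : IsRegular (symProd m g.toLinearMap f.toLinearMap) := by
  obtain ⟨ψ, hψ, -⟩ := exists_dominating f
  refine ⟨symProd m g.toLinearMap ψ.toLinearMap,
    symProd m g.toLinearMap (ψ.toLinearMap - f.toLinearMap),
    isPositive_symProd hg fun x hx => (abs_nonneg _).trans (hψ x hx),
    isPositive_symProd hg fun x hx => sub_nonneg.2 ((le_abs_self _).trans (hψ x hx)), ?_⟩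
  rw [map_sub, sub_sub_cancel]

variable (m) in
/-- The operator `f ↦ symProd m g f` from the dual to the regular forms. -/
noncomputable def symProdForm (g : StrongDual ℝ E) (hg : ∀ x, 0 ≤ x → 0 ≤ g x) :
    StrongDual ℝ E →L[ℝ] RegForm m E :=
  LinearMap.mkContinuous
    { toFun := fun f => ⟨symProd m g.toLinearMap f.toLinearMap, isRegular_symProd hg f⟩
      map_add' := fun f₁ f₂ => RegForm.form_injective
        ((symProd m g.toLinearMap).map_add f₁.toLinearMap f₂.toLinearMap)
      map_smul' := fun c f => RegForm.form_injective
        ((symProd m g.toLinearMap).map_smul c f.toLinearMap) }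
    (m * ‖g‖ ^ (m - 1)) fun f => by
      -- For the regular norm the product must be dominated by a positive form. The product with `ψ`
      -- in place of `f` does this, and `‖ψ‖ ≤ ‖f‖` keeps the constant.
      obtain ⟨ψ, hψ, hψn⟩ := exists_dominating f
      refine RegForm.norm_le
        (S := ⟨symProd m g.toLinearMap ψ.toLinearMap, isRegular_symProd hg ψ⟩)
        (by positivity) (fun x hx => ?_) fun x hx => (symProd_le g ψ x).trans ?_
      · have h1 : IsPositive (symProd m g.toLinearMap (ψ.toLinearMap - f.toLinearMap)) :=
          isPositive_symProd hg fun x hx => sub_nonneg.2 ((le_abs_self _).trans (hψ x hx))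
        have h2 : IsPositive (symProd m g.toLinearMap (ψ.toLinearMap + f.toLinearMap)) :=
          isPositive_symProd hg fun x hx => neg_le_iff_add_nonneg.1 ((neg_le_abs _).trans (hψ x hx))
        rw [map_sub] at h1
        rw [map_add] at h2
        exact abs_le'.2 ⟨sub_nonneg.1 (h1 x hx), neg_le_iff_add_nonneg.2 (h2 x hx)⟩
      · rw [mul_assoc (m : ℝ) (‖g‖ ^ (m - 1)) ‖f‖, mul_comm (‖g‖ ^ (m - 1))]
        gcongr

theorem symProdForm_form (g : StrongDual ℝ E) (hg : ∀ x, 0 ≤ x → 0 ≤ g x) (f : StrongDual ℝ E) :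
    (symProdForm m g hg f).form = symProd m g.toLinearMap f.toLinearMap := rfl

theorem symProdForm_nonneg {g : StrongDual ℝ E} (hg : ∀ x, 0 ≤ x → 0 ≤ g x) {f : StrongDual ℝ E}
    (hf : 0 ≤ f) : 0 ≤ symProdForm m g hg f :=
  RegForm.nonneg_iff.2 (isPositive_symProd hg hf)

theorem isAssociated_symProd (g f : E →ₗ[ℝ] ℝ) :
    IsAssociated (fun x => symProd m g f fun _ => x) (symProd m g f) :=
  ⟨isSymmetric_symProd g f, fun _ => rfl⟩

theorem isRegPoly_symProd {g : StrongDual ℝ E} (hg : ∀ x, 0 ≤ x → 0 ≤ g x)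
    (f : StrongDual ℝ E) : IsRegPoly m fun x => symProd m g.toLinearMap f.toLinearMap fun _ => x := by
  obtain ⟨ψ, hψ, -⟩ := exists_dominating f
  refine ⟨_, _,
    ⟨symProd m g.toLinearMap ψ.toLinearMap, isAssociated_symProd _ _,
      isPositive_symProd hg fun x hx => (abs_nonneg _).trans (hψ x hx)⟩,
    ⟨symProd m g.toLinearMap (ψ.toLinearMap - f.toLinearMap), isAssociated_symProd _ _,
      isPositive_symProd hg fun x hx => sub_nonneg.2 ((le_abs_self _).trans (hψ x hx))⟩, ?_⟩
  ext x
  rw [map_sub]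
  simp

variable (m) in
/-- The operator taking `f` to the polynomial `x ↦ m * f x * g x ^ (m - 1)`. -/
noncomputable def symProdPoly (g : StrongDual ℝ E) (hg : ∀ x, 0 ≤ x → 0 ≤ g x) :
    StrongDual ℝ E →L[ℝ] RegPoly m E :=
  LinearMap.mkContinuous
    { toFun := fun f => ⟨_, isRegPoly_symProd hg f⟩
      map_add' := fun f₁ f₂ => RegPoly.fn_injective (funext fun x => MultilinearMap.congr_fun
        ((symProd m g.toLinearMap).map_add f₁.toLinearMap f₂.toLinearMap) fun _ => x)
      map_smul' := fun c f => RegPoly.fn_injective (funext fun x => MultilinearMap.congr_fun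
        ((symProd m g.toLinearMap).map_smul c f.toLinearMap) fun _ => x) }
    (m * ‖g‖ ^ (m - 1)) fun f => by
      obtain ⟨ψ, hψ, hψn⟩ := exists_dominating f
      refine RegPoly.norm_le (Q := ⟨_, isRegPoly_symProd hg ψ⟩) (by positivity) ?_ ?_
        fun x _ => (symProd_le g ψ fun _ => x).trans ?_
      · exact ⟨_, (isAssociated_symProd _ _).sub (isAssociated_symProd _ _), by
          rw [← map_sub]
          exact isPositive_symProd hg fun x hx => sub_nonneg.2 ((le_abs_self _).trans (hψ x hx))⟩
      · exact ⟨_, (isAssociated_symProd _ _).sub (isAssociated_symProd _ _).neg, by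
          rw [sub_neg_eq_add, ← map_add]
          exact isPositive_symProd hg fun x hx =>
            neg_le_iff_add_nonneg.1 ((neg_le_abs _).trans (hψ x hx))⟩
      · simp only [Finset.prod_const, Finset.card_univ, Fintype.card_fin]
        rw [mul_assoc (m : ℝ) (‖g‖ ^ (m - 1)) ‖f‖, mul_comm (‖g‖ ^ (m - 1))]
        gcongr

theorem symProdPoly_fn (g : StrongDual ℝ E) (hg : ∀ x, 0 ≤ x → 0 ≤ g x) (f : StrongDual ℝ E)
    (x : E) : (symProdPoly m g hg f).fn x = symProd m g.toLinearMap f.toLinearMap fun _ => x := rfl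

theorem symProdPoly_nonneg {g : StrongDual ℝ E} (hg : ∀ x, 0 ≤ x → 0 ≤ g x) {f : StrongDual ℝ E}
    (hf : 0 ≤ f) : 0 ≤ symProdPoly m g hg f :=
  RegPoly.nonneg_iff.2 ⟨_, isAssociated_symProd _ _, isPositive_symProd hg hf⟩

/-- A positive functional `f` is bounded by the polynomial `x ↦ m * f x * g x ^ (m - 1)`. -/
theorem norm_le_of_symProd_le (hm : 1 ≤ m) {g f : StrongDual ℝ E} (hg : ∀ x, 0 ≤ x → 0 ≤ g x)
    (hf : 0 ≤ f) {y : E} (hy : 0 ≤ y) (hgy : g y = 1) {C : ℝ} (hC : 0 ≤ C)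
    (h : ∀ x, (symProd m g.toLinearMap f.toLinearMap fun _ => x) ≤ C * ‖x‖ ^ m) :
    ‖f‖ ≤ (1 + ‖y‖) ^ m * C := by
  refine f.opNorm_le_of_unit_norm (by positivity) fun x hx => ?_
  have hf' : ∀ x, 0 ≤ x → 0 ≤ f x := hf
  have habs : |f x| ≤ f |x| := by
    rw [abs_le']
    constructor
    · have := hf' _ (sub_nonneg.2 (le_abs_self x))
      rwa [map_sub, sub_nonneg] at this
    · have := hf' _ (neg_le_iff_add_nonneg.1 (neg_le_abs x))
      rw [map_add] at this
      linarith
  have hfx := hf' _ (abs_nonneg x)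
  -- The functional `g` may vanish at `|x|`. Adding `y` makes it at least `1` without decreasing
  -- `f`, so the factors `g ^ (m - 1)` and `m ≥ 1` can be dropped; the price is the norm `1 + ‖y‖`
  -- of the new point.
  have h1 : f |x| ≤ f (|x| + y) := by
    rw [map_add]
    exact le_add_of_nonneg_right (hf' _ hy)
  have h2 : 1 ≤ g (|x| + y) := by
    rw [map_add, hgy]
    exact le_add_of_nonneg_left (hg _ (abs_nonneg x))
  have h3 : 1 ≤ g (|x| + y) ^ (m - 1) := one_le_pow₀ h2
  have h4 : f (|x| + y) ≤ m * (f (|x| + y) * g (|x| + y) ^ (m - 1)) := by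
    have hm' : (1 : ℝ) ≤ m := by exact_mod_cast hm
    have h0 := hfx.trans h1
    calc f (|x| + y) ≤ f (|x| + y) * g (|x| + y) ^ (m - 1) := le_mul_of_one_le_right h0 h3
      _ ≤ _ := le_mul_of_one_le_left (by positivity) hm'
  have h5 := h (|x| + y)
  rw [symProd_diag] at h5
  have h6 : ‖|x| + y‖ ≤ 1 + ‖y‖ := by
    refine (norm_add_le _ _).trans ?_
    rw [norm_abs_eq_norm, hx]
  have h7 : C * ‖|x| + y‖ ^ m ≤ (1 + ‖y‖) ^ m * C := by
    rw [mul_comm]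
    gcongr
  exact habs.trans (h1.trans (h4.trans (h5.trans h7)))

/-- A norming functional at `|x|` need not be positive, but a positive majorant of it is still
nonzero at `|x|`, and `|x|` can be rescaled. -/
theorem exists_positive_eq_one [Nontrivial E] :
    ∃ (g : StrongDual ℝ E) (y : E), (∀ x, 0 ≤ x → 0 ≤ g x) ∧ 0 ≤ y ∧ g y = 1 := by
  obtain ⟨x, hx⟩ := exists_ne (0 : E)
  have hx' : ‖|x|‖ ≠ 0 := by rwa [norm_abs_eq_norm, norm_ne_zero_iff]
  obtain ⟨f, -, hf⟩ := exists_dual_vector ℝ |x| hx'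
  obtain ⟨ψ, hψ, -⟩ := exists_dominating f
  have hpos : 0 < ψ |x| := by
    refine lt_of_lt_of_le ?_ (hψ _ (abs_nonneg x))
    rw [hf]
    simpa using hx'
  refine ⟨ψ, (ψ |x|)⁻¹ • |x|, fun x hx => (abs_nonneg _).trans (hψ x hx),
    smul_nonneg (by positivity) (abs_nonneg x), ?_⟩
  rw [map_smul, smul_eq_mul, inv_mul_cancel₀ hpos.ne']

theorem hasPSP_dual_of_subsingleton [Subsingleton E] : HasPSP (StrongDual ℝ E) := by
  intro u _ _
  have : ∀ n, u n = 0 := fun n => by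
    ext x
    rw [Subsingleton.elim x 0, map_zero, map_zero]
  simp [this]

/-- The condition `1 ≤ m` is essential: in degree zero the symmetrized product is an empty sum, and
forms of degree zero always have the property. -/
theorem HasPSP.dual_of_regForm (hm : 1 ≤ m) (h : HasPSP (RegForm m E)) :
    HasPSP (StrongDual ℝ E) := by
  -- A nonzero `g` exists only on a nontrivial space; otherwise the dual is zero.
  cases subsingleton_or_nontrivial E
  · exact hasPSP_dual_of_subsingleton
  obtain ⟨g, y, hg, hy, hgy⟩ := exists_positive_eq_one (E := E)
  refine h.of_bounded_below (symProdForm m g hg) (fun f hf => symProdForm_nonneg hg hf)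
    ((1 + ‖y‖) ^ m) fun f hf => ?_
  refine norm_le_of_symProd_le hm hg hf hy hgy (norm_nonneg _) fun x => ?_
  have := (symProdForm m g hg f).form_le_norm fun _ => x
  simp only [Finset.prod_const, Finset.card_univ, Fintype.card_fin, symProdForm_form] at this
  exact (le_abs_self _).trans this

theorem HasPSP.dual_of_regPoly (hm : 1 ≤ m) (h : HasPSP (RegPoly m E)) :
    HasPSP (StrongDual ℝ E) := by
  cases subsingleton_or_nontrivial E
  · exact hasPSP_dual_of_subsingleton
  obtain ⟨g, y, hg, hy, hgy⟩ := exists_positive_eq_one (E := E)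
  refine h.of_bounded_below (symProdPoly m g hg) (fun f hf => symProdPoly_nonneg hg hf)
    ((1 + ‖y‖) ^ m) fun f hf => ?_
  refine norm_le_of_symProd_le hm hg hf hy hgy (norm_nonneg _) fun x => ?_
  have := RegPoly.fn_le_norm (symProdPoly_nonneg (m := m) hg hf) x
  rw [symProdPoly_fn] at this
  exact (le_abs_self _).trans this

end Converse

end RegularForms

theorem corollary4p6 {E : Type*} [NormedAddCommGroup E] [NormedSpace ℝ E] [Lattice E]
    [IsOrderedAddMonoid E] [IsOrderedModule ℝ E] [HasSolidNorm E] [CompleteSpace E] :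
    List.TFAE [
      RegularForms.HasPSP (StrongDual ℝ E),
      ∀ m : ℕ, 1 ≤ m → RegularForms.HasPSP (RegularForms.RegForm m E),
      ∃ m : ℕ, 1 ≤ m ∧ RegularForms.HasPSP (RegularForms.RegForm m E),
      ∀ m : ℕ, 1 ≤ m → RegularForms.HasPSP (RegularForms.RegPoly m E),
      ∃ m : ℕ, 1 ≤ m ∧ RegularForms.HasPSP (RegularForms.RegPoly m E)] := by
  tfae_have 1 → 2 := fun h m _ => RegularForms.hasPSP_regForm h m
  tfae_have 2 → 3 := fun h => ⟨1, le_rfl, h 1 le_rfl⟩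
  tfae_have 3 → 1 := fun ⟨_, hm, h⟩ => h.dual_of_regForm hm
  tfae_have 2 → 4 := fun h m hm => (h m hm).regPoly
  tfae_have 4 → 5 := fun h => ⟨1, le_rfl, h 1 le_rfl⟩
  tfae_have 5 → 1 := fun ⟨_, hm, h⟩ => h.dual_of_regPoly hm
  tfae_finish
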